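/- Let $n\ge 1$ and write $x=(x',x_n)\in\mathbb R^{n-1}\times\mathbb R=\mathbb R^n$; for a function $h$ on $\mathbb R^n$ put $h_{x'}(t)=h(x',t)$. A function $h:\mathbb R\to\mathbb R$ is symmetric decreasing if $h(t)\le h(s)$ whenever $|s|\le|t|$, and strictly symmetric decreasing if moreover $h(t)<h(s)$ whenever $|s|<|t|$. For measurable $A\subseteq\mathbb R$ let $A^*$ be the open interval centred at $0$ with the same length as $A$ ($A^*=\mathbb R$ if $A$ has infinite measure, $A^*=\emptyset$ if $A$ is null). The Steiner symmetrization of $f:\mathbb R^n\to[0,\infty)$ with respect to $x_n$ is $$f^\#(x',x_n)=\sup\{\tau>0 : x_n\in\{y\in\mathbb R: f(x',y)>\tau\}^*\},\qquad \sup\emptyset=0.$$ Let $J:\mathbb R\to[0,\infty)$ be convex with $J(0)=0$, and let $k\in L^1(\mathbb R^n)$ be such that $k_{x'}$ is symmetric decreasing on $\mathbb R$ for every $x'\in\mathbb R^{n-1}$. For non-negative measurable functions $f,g:\mathbb R^n\to[0,\infty)$ set $$\mathcal E[f,g]=\int_{\mathbb R^n}\int_{\mathbb R^n}J(f(x)-g(y))\,k(x-y)\,dy\,dx\in[0,\infty].$$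 Suppose that for a.e. $x'\in\mathbb R^{n-1}$ the sets $\{f_{x'}>\tau\}$ and $\{g_{x'}>\tau\}$ have finite measure for all $\tau>0$. Then: 1. $\mathcal E[f,g]\ge\mathcal E[f^\#,g^\#]$. 2. Suppose in addition that $\mathcal E[f,g]<\infty$ and that $k_{x'}$ is strictly symmetric decreasing for every $x'\in\mathbb R^{n-1}$. (a) If $J$ is strictly convex, then $\mathcal E[f,g]=\mathcal E[f^\#,g^\#]$ if and only if $f=0$ a.e., or $g=0$ a.e., or there exists $c\in\mathbb R$ such that for a.e. $x'\in\mathbb R^{n-1}$ $$f(x',x_n)=f^\#(x',x_n-c)\quad\text{and}\quad g(x',x_n)=g^\#(x',x_n-c)\quad\text{for a.e. }x_n\in\mathbb R.$$ (b) If $J(t)=|t|$, then $\mathcal E[f,g]=\mathcal E[f^\#,g^\#]$ if and only if for a.e. $\tau>0$ for which both $\{f>\tau\}$ and $\{g>\tau\}$ have positive measure in $\mathbb R^n$, there exists $c_\tau\in\mathbb R$ such that for a.e. $x'\in\mathbb R^{n-1}$ each of the sets $\{x_n: f(x',x_n)>\tau\}$ and $\{x_n: g(x',x_n)>\tau\}$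 agrees up to a null set with a bounded, possibly degenerate, interval centred at $c_\tau$. -/

import Mathlib

open MeasureTheory Set
open scoped ENNReal

/-- The decomposition `ℝⁿ = ℝⁿ⁻¹ × ℝ` with `n = d + 1`; a point is `x = (x', xₙ)`. Only the Lebesgue
measure and the additive group structure of this space are used. -/
abbrev SplitSpace (d : ℕ) : Type := EuclideanSpace ℝ (Fin d) × ℝ

/-- Symmetric decreasing functions on `ℝ`: even and non-increasing in `|t|`. -/
def SymmDecreasing (h : ℝ → ℝ) : Prop :=
  ∀ s t : ℝ, |s| ≤ |t| → h t ≤ h s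

/-- Strictly symmetric decreasing functions on `ℝ`. -/
def StrictSymmDecreasing (h : ℝ → ℝ) : Prop :=
  SymmDecreasing h ∧ ∀ s t : ℝ, |s| < |t| → h t < h s

/-- The Schwarz symmetrization `A^*` of a set `A ⊆ ℝ`: the open interval centred at the origin with
the same length as `A`, and all of `ℝ` when `A` has infinite measure. -/
def schwarzSet (A : Set ℝ) : Set ℝ :=
  {t : ℝ | ENNReal.ofReal (2 * |t|) < volume A}

/-- The Steiner symmetrization of `f` with respect to `xₙ`:
`f^#(x', xₙ) = sup {τ > 0 | xₙ ∈ {y | f(x', y) > τ}^*}`, with `sup ∅ = 0`.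
If the level sets of the slice at `x'` have finite measure, then the set under the supremum is
bounded for every `xₙ ≠ 0`. -/
noncomputable def steiner {d : ℕ} (f : SplitSpace d → ℝ) : SplitSpace d → ℝ :=
  fun x => sSup {τ : ℝ | 0 < τ ∧ x.2 ∈ schwarzSet {y : ℝ | τ < f (x.1, y)}}

/-- `E[f,g] = ∫ ∫ J(f(x) - g(y)) k(x - y) dy dx`, with values in `[0, ∞]`.  The integrand is
non-negative almost everywhere for the kernels considered, because an integrable symmetric
decreasing function on `ℝ` is non-negative. -/
noncomputable def nonlocalEnergy {d : ℕ} (J : ℝ → ℝ) (k f g : SplitSpace d → ℝ) : ℝ≥0∞ :=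
  ∫⁻ x, ∫⁻ y, ENNReal.ofReal (J (f x - g y) * k (x - y))

/-- `A ⊆ ℝ` agrees up to a null set with a bounded interval centred at `c` (the degenerate interval
`{c}`, of radius `0`, is allowed). -/
def EquivIntervalAround (A : Set ℝ) (c : ℝ) : Prop :=
  ∃ r : ℝ, 0 ≤ r ∧ A =ᵐ[volume] Icc (c - r) (c + r)

/-! Everything reduces to Riesz's rearrangement inequality for two sets on the line, with its
equality case. On each half-line a non-negative convex `J` with `J 0 = 0` is a superposition of the
ramps `(t - s)₊`, `s ≥ 0`, against the Stieltjes measure `ν` of its right derivative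
(`ConvexOn.exists_measure_lintegral_eq`). The ramp has the layer-cake form `(f - g - s)₊ = ∫_{τ > 0}
1{f > τ + s} 1{g ≤ τ} dτ`. By Tonelli the energy is an integral, over `s`, `τ` and pairs of lines
above `x'` and `y'`, of overlaps of `{f > τ + s}` with the complement of `{g > τ}` through the
kernel slice at `x' - y'` (`layerEnergy_eq`). The overlaps with a set and with its complement add up
to a finite constant that symmetrization preserves, so Riesz's upper bound becomes the required
lower bound.

A symmetric decreasing kernel is a superposition of indicators of `(-r, r)`. For one such window,
let `F_B` be the distribution function of `B`, let `y` be a quantile function of `A`, and write `a =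
|A|`, `b = |B|`. The overlap is the integral over `(0, a)` of `F_B (y v + r) - F_B (y v - r)`.
Shifting the second term by `h` pairs `F_B (y v + r)` with `F_B (y (v + h) - r)`. Since `F_B` is
1-Lipschitz and `y (v + h) - y v ≥ h`, the overlap is at most `h b + (a - h)(2r - h)`, and for
centred intervals a suitable `h` attains this. If `|a - b| / 2 < r < (a + b) / 2`, equality forces
`y v - v` to be constant and `B` to fill every window, so `A` and `B` are concentric intervals.

Equality of finite energies forces equality in Riesz for almost every `(s, τ, x', y')`. Strict
monotonicity of the kernel supplies windows in the range just named, and uniqueness of the centre of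
a non-null interval makes the centre independent of the lines (`sharedCenter_of_ae`). For `J t =
|t|` both layer measures are the Dirac mass at `0`, so only equal levels of `f` and `g` are coupled
and the centre may depend on `τ`. For strictly convex `J` the layer measures charge every interval
of `[0, ∞)`, so different levels are coupled too and a single centre remains
(`exists_common_center`). -/

/-! ### Distribution and quantile functions of subsets of the line -/

/-- The distribution function `t ↦ |A ∩ (-∞, t]|` of a set of finite measure. -/
noncomputable def cumul (A : Set ℝ) (t : ℝ) : ℝ := volume.real (A ∩ Iic t)

theorem cumul_nonneg (A : Set ℝ) (t : ℝ) : 0 ≤ cumul A t := measureReal_nonneg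

theorem cumul_le {A : Set ℝ} (hA : volume A ≠ ∞) (t : ℝ) : cumul A t ≤ volume.real A :=
  measureReal_mono inter_subset_left hA

theorem cumul_mono {A : Set ℝ} (hA : volume A ≠ ∞) : Monotone (cumul A) := fun _ _ h =>
  measureReal_mono (inter_subset_inter_right _ (Iic_subset_Iic.2 h))
    (measure_ne_top_of_subset inter_subset_left hA)

theorem cumul_sub {A : Set ℝ} (hA : volume A ≠ ∞) {s t : ℝ}
    (h : s ≤ t) : cumul A t - cumul A s = volume.real (A ∩ Ioc s t) := by
  have h1 : A ∩ Iic t = (A ∩ Iic s) ∪ (A ∩ Ioc s t) := by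
    rw [← inter_union_distrib_left, Iic_union_Ioc_eq_Iic h]
  have h2 : volume.real (A ∩ Iic t) = volume.real (A ∩ Iic s) + volume.real (A ∩ Ioc s t) := by
    have h3 := measureReal_inter_add_sdiff (μ := volume) (s := A ∩ Iic t) (t := Iic s)
      measurableSet_Iic (measure_ne_top_of_subset inter_subset_left hA)
    have h4 : A ∩ Iic t ∩ Iic s = A ∩ Iic s := by
      rw [inter_assoc, Iic_inter_Iic, min_eq_right h]
    have h5 : (A ∩ Iic t) \ Iic s = A ∩ Ioc s t := by
      ext x; simp only [mem_sdiff, mem_inter_iff, mem_Iic, mem_Ioc, not_le]; tauto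
    rw [h4, h5] at h3
    exact h3.symm
  unfold cumul
  linarith

theorem cumul_sub_le {A : Set ℝ} (hA : volume A ≠ ∞) {s t : ℝ}
    (h : s ≤ t) : cumul A t - cumul A s ≤ t - s := by
  rw [cumul_sub hA h]
  calc volume.real (A ∩ Ioc s t) ≤ volume.real (Ioc s t) :=
        measureReal_mono inter_subset_right (by simp)
    _ = t - s := by simp [Measure.real, ENNReal.toReal_ofReal (sub_nonneg.2 h)]

theorem cumul_continuous {A : Set ℝ} (hA : volume A ≠ ∞) :
    Continuous (cumul A) := by
  have : LipschitzWith 1 (cumul A) := by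
    refine LipschitzWith.of_le_add fun x y => ?_
    rw [Real.dist_eq]
    rcases le_total x y with h | h
    · have := cumul_mono hA h
      have := abs_nonneg (x - y)
      linarith
    · have := cumul_sub_le hA h
      have := le_abs_self (x - y)
      linarith
  exact this.continuous

theorem exists_cumul_eq {A : Set ℝ} (hA : volume A ≠ ∞) {v : ℝ}
    (hv : v ∈ Ioo 0 (volume.real A)) : ∃ y, cumul A y = v := by
  have key : Filter.Tendsto (fun n : ℕ => cumul A n) Filter.atTop (nhds (volume.real A)) := by
    have h := tendsto_measure_iUnion_atTop (μ := volume) (s := fun n : ℕ => A ∩ Iic (n : ℝ))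
      (fun m n h => inter_subset_inter_right _ (Iic_subset_Iic.2 (by exact_mod_cast h)))
    rw [← inter_iUnion, iUnion_Iic_of_not_bddAbove_range, inter_univ] at h
    · exact (ENNReal.tendsto_toReal hA).comp h
    · rintro ⟨M, hM⟩
      obtain ⟨n, hn⟩ := exists_nat_gt M
      exact absurd (hM ⟨n, rfl⟩) (not_le.2 hn)
  have key2 : Filter.Tendsto (fun n : ℕ => cumul A (-(n : ℝ))) Filter.atTop (nhds 0) := by
    have h := tendsto_measure_iInter_atTop (μ := volume.restrict A)
      (s := fun n : ℕ => Iic (-(n : ℝ)))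
      (fun _ => measurableSet_Iic.nullMeasurableSet)
      (fun m n h => Iic_subset_Iic.2 (by simpa using h))
      ⟨0, by
        rw [Measure.restrict_apply measurableSet_Iic]
        exact measure_ne_top_of_subset inter_subset_right hA⟩
    have h0 : (⋂ n : ℕ, Iic (-(n : ℝ))) = ∅ := by
      refine eq_empty_of_forall_notMem fun x hx => ?_
      obtain ⟨n, hn⟩ := exists_nat_gt (-x)
      have := mem_iInter.1 hx n
      simp only [mem_Iic] at this
      linarith
    rw [h0, measure_empty] at h
    have h2 := (ENNReal.tendsto_toReal (by simp)).comp h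
    refine h2.congr fun n => ?_
    simp [cumul, Measure.real, Measure.restrict_apply, inter_comm]
  refine mem_range_of_exists_le_of_exists_ge (cumul_continuous hA) ?_ ?_
  · obtain ⟨n, hn⟩ := (key2.eventually (gt_mem_nhds hv.1)).exists
    exact ⟨_, hn.le⟩
  · obtain ⟨n, hn⟩ := (key.eventually (lt_mem_nhds hv.2)).exists
    exact ⟨_, hn.le⟩

/-- `y` is a quantile function of `A`: a right inverse of the distribution function. -/
def IsQuantile (A : Set ℝ) (y : ℝ → ℝ) : Prop :=
  ∀ v ∈ Ioo 0 (volume.real A), cumul A (y v) = v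

theorem exists_isQuantile {A : Set ℝ} (hA : volume A ≠ ∞) :
    ∃ y, IsQuantile A y := by
  have : ∀ v, ∃ y, v ∈ Ioo 0 (volume.real A) → cumul A y = v := fun v => by
    by_cases hv : v ∈ Ioo 0 (volume.real A)
    · obtain ⟨y, hy⟩ := exists_cumul_eq hA hv
      exact ⟨y, fun _ => hy⟩
    · exact ⟨0, fun h => absurd h hv⟩
  choose y hy using this
  exact ⟨y, hy⟩

namespace IsQuantile

variable {A : Set ℝ} {y : ℝ → ℝ}

/-- The distribution function is 1-Lipschitz, so a right inverse of it cannot shrink distances. -/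
theorem sub_le (hy : IsQuantile A y) (hA : volume A ≠ ∞) {v w : ℝ}
    (hv : v ∈ Ioo 0 (volume.real A)) (hw : w ∈ Ioo 0 (volume.real A)) (h : v ≤ w) :
    w - v ≤ y w - y v := by
  rcases le_total (y v) (y w) with h1 | h1
  · have := cumul_sub_le hA h1
    rwa [hy v hv, hy w hw] at this
  · have := cumul_mono hA h1
    rw [hy v hv, hy w hw] at this
    have : v = w := le_antisymm h this
    simp [this]

theorem monotoneOn (hy : IsQuantile A y) (hA : volume A ≠ ∞) :
    MonotoneOn y (Ioo 0 (volume.real A)) := fun v hv w hw h => by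
  have := hy.sub_le hA hv hw h
  linarith

theorem aemeasurable (hy : IsQuantile A y) (hA : volume A ≠ ∞) :
    AEMeasurable y (volume.restrict (Ioo 0 (volume.real A))) :=
  aemeasurable_restrict_of_monotoneOn measurableSet_Ioo (hy.monotoneOn hA)

/-- Two finite measures on the line agree if they agree on every `Iic t`. Here `{v | y v ≤ t}` is
squeezed between `(0, F t)` and `(0, F t]`, where `F` is the distribution function of `A`. -/
theorem map_eq (hy : IsQuantile A y) (hA : volume A ≠ ∞) :
    Measure.map y (volume.restrict (Ioo 0 (volume.real A))) = volume.restrict A := by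
  have : IsFiniteMeasure (volume.restrict (Ioo (0 : ℝ) (volume.real A))) := ⟨by simp⟩
  have hfin : IsFiniteMeasure (Measure.map y (volume.restrict (Ioo 0 (volume.real A)))) :=
    Measure.isFiniteMeasure_map _ _
  refine Measure.ext_of_Iic _ _ fun t => ?_
  rw [Measure.map_apply_of_aemeasurable (hy.aemeasurable hA) measurableSet_Iic,
    Measure.restrict_apply measurableSet_Iic]
  have hreal : volume (Iic t ∩ A) = ENNReal.ofReal (cumul A t) := by
    rw [cumul, inter_comm, ofReal_measureReal (measure_ne_top_of_subset inter_subset_left hA)]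
  rw [hreal, Measure.restrict_apply₀']
  swap
  · exact measurableSet_Ioo.nullMeasurableSet
  apply le_antisymm
  · calc volume (y ⁻¹' Iic t ∩ Ioo 0 (volume.real A)) ≤ volume (Ioc 0 (cumul A t)) := by
          refine measure_mono fun v hv => ⟨hv.2.1, ?_⟩
          rw [← hy v hv.2]
          exact cumul_mono hA hv.1
      _ = ENNReal.ofReal (cumul A t) := by simp
  · calc ENNReal.ofReal (cumul A t) = volume (Ioo 0 (cumul A t)) := by simp
      _ ≤ _ := by
          refine measure_mono fun v hv => ?_
          have hv' : v ∈ Ioo 0 (volume.real A) := ⟨hv.1, hv.2.trans_le (cumul_le hA t)⟩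
          refine ⟨?_, hv'⟩
          by_contra hlt
          have h1 : t < y v := not_le.1 hlt
          have := cumul_mono hA h1.le
          rw [hy v hv'] at this
          exact absurd hv.2 (not_lt.2 this)

theorem setLIntegral_eq (hy : IsQuantile A y) (hA : volume A ≠ ∞) {φ : ℝ → ℝ≥0∞}
    (hφ : Measurable φ) :
    ∫⁻ s in A, φ s = ∫⁻ v in Ioo 0 (volume.real A), φ (y v) := by
  rw [← hy.map_eq hA, lintegral_map' hφ.aemeasurable (hy.aemeasurable hA)]

theorem intervalIntegrable (hy : IsQuantile A y) (hA : volume A ≠ ∞) {B : Set ℝ}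
    (hB : volume B ≠ ∞) (r : ℝ) :
    IntervalIntegrable (fun v => cumul B (y v + r)) volume 0 (volume.real A) := by
  rw [intervalIntegrable_iff_integrableOn_Ioo_of_le measureReal_nonneg]
  have : IsFiniteMeasure (volume.restrict (Ioo (0 : ℝ) (volume.real A))) := ⟨by simp⟩
  refine Integrable.of_bound (C := volume.real B) ?_ ?_
  · exact ((cumul_continuous hB).measurable.comp_aemeasurable
      ((hy.aemeasurable hA).add_const r)).aestronglyMeasurable
  · refine Filter.Eventually.of_forall fun v => ?_
    rw [Real.norm_eq_abs, abs_of_nonneg (cumul_nonneg _ _)]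
    exact cumul_le hB _

end IsQuantile

/-! ### Riesz's inequality for the indicator of an interval -/

/-- The interaction `∫_A ∫_B w(s - t) dt ds` of two sets through the kernel `w`. -/
noncomputable def overlap (w : ℝ → ℝ≥0∞) (A B : Set ℝ) : ℝ≥0∞ :=
  ∫⁻ s in A, ∫⁻ t in B, w (s - t)

/-- The interaction of two sets through the indicator function of `(-r, r)`. -/
noncomputable def windowOverlap (r : ℝ) (A B : Set ℝ) : ℝ≥0∞ :=
  overlap ((Ioo (-r) r).indicator 1) A B

theorem lintegral_window {B : Set ℝ} (hB : volume B ≠ ∞) {r : ℝ}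
    (hr : 0 ≤ r) (s : ℝ) :
    ∫⁻ t in B, (Ioo (-r) r).indicator 1 (s - t) =
      ENNReal.ofReal (cumul B (s + r) - cumul B (s - r)) := by
  have h1 : ∀ t, (Ioo (-r) r).indicator (1 : ℝ → ℝ≥0∞) (s - t) =
      (Ioo (s - r) (s + r)).indicator 1 t := fun t => by
    simp only [indicator, mem_Ioo]
    congr 1
    apply propext
    constructor <;> rintro ⟨h, h'⟩ <;> constructor <;> linarith
  simp_rw [h1]
  rw [lintegral_indicator_one measurableSet_Ioo, Measure.restrict_apply measurableSet_Ioo,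
    cumul_sub hB (by linarith), ofReal_measureReal
    (measure_ne_top_of_subset inter_subset_left hB), inter_comm]
  exact measure_congr ((Filter.EventuallyEq.refl _ _).inter Ioo_ae_eq_Ioc)

theorem windowOverlap_eq {A B : Set ℝ} {y : ℝ → ℝ} (hy : IsQuantile A y)
    (hA : volume A ≠ ∞) (hB : volume B ≠ ∞) {r : ℝ} (hr : 0 ≤ r) :
    windowOverlap r A B = ENNReal.ofReal
      (∫ v in 0..volume.real A, (cumul B (y v + r) - cumul B (y v - r))) := by
  unfold windowOverlap overlap
  simp_rw [lintegral_window hB hr]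
  rw [hy.setLIntegral_eq hA (φ := fun s => ENNReal.ofReal (cumul B (s + r) - cumul B (s - r)))]
  swap
  · have := (cumul_continuous hB).measurable
    fun_prop
  have hint := (hy.intervalIntegrable hA hB r).sub (hy.intervalIntegrable hA hB (-r))
  simp only [← sub_eq_add_neg] at hint
  rw [intervalIntegral.integral_of_le measureReal_nonneg]
  rw [integral_Ioc_eq_integral_Ioo, ofReal_integral_eq_lintegral_ofReal]
  · exact (intervalIntegrable_iff_integrableOn_Ioo_of_le measureReal_nonneg).1 hint
  · refine Filter.Eventually.of_forall fun v => ?_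
    have := cumul_mono hB (show y v - r ≤ y v + r by linarith)
    simpa using this

/-- Substituting `v + h` for `v` in the integral of `q` over `[h, a]` pairs `p v` with `q (v + h)`
and leaves two end pieces of length `h`. The freedom in `h` is what makes the resulting bound sharp.
-/
theorem integral_sub_split {p q : ℝ → ℝ} {a h : ℝ} (hh : 0 ≤ h) (hha : h ≤ a)
    (hp : IntervalIntegrable p volume 0 a) (hq : IntervalIntegrable q volume 0 a) :
    ∫ v in 0..a, (p v - q v) = (∫ v in (a - h)..a, p v) - (∫ v in 0..h, q v) +
      ∫ v in 0..(a - h), (p v - q (v + h)) := by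
  have sub : ∀ {c d : ℝ}, 0 ≤ c → c ≤ d → d ≤ a → uIcc c d ⊆ uIcc 0 a := fun h1 h2 h3 => by
    rw [uIcc_of_le h2, uIcc_of_le (h1.trans (h2.trans h3))]
    exact Icc_subset_Icc h1 h3
  have hq' : IntervalIntegrable q volume h a := hq.mono_set (sub hh hha le_rfl)
  have hqs : IntervalIntegrable (fun v => q (v + h)) volume 0 (a - h) := by
    simpa using hq'.comp_add_right h
  have hp1 : IntervalIntegrable p volume 0 (a - h) :=
    hp.mono_set (sub le_rfl (by linarith) (by linarith))
  have hp2 : IntervalIntegrable p volume (a - h) a :=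
    hp.mono_set (sub (by linarith) (by linarith) le_rfl)
  have hq1 : IntervalIntegrable q volume 0 h := hq.mono_set (sub le_rfl hh hha)
  rw [intervalIntegral.integral_sub hp hq, intervalIntegral.integral_sub hp1 hqs,
    intervalIntegral.integral_comp_add_right q h, zero_add, sub_add_cancel,
    ← intervalIntegral.integral_add_adjacent_intervals hp1 hp2,
    ← intervalIntegral.integral_add_adjacent_intervals hq1 hq']
  ring

section Window

variable {A B : Set ℝ} {y : ℝ → ℝ} {r h : ℝ}

/-- The window from `y (v + h) - r` to `y v + r` has length at most `2 * r - h`, because quantiles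
do not shrink distances. If its endpoints are in reverse order the left side is non-positive, and `h
≤ 2 * r` suffices. -/
theorem IsQuantile.cumul_window_le (hy : IsQuantile A y) (hA : volume A ≠ ∞) (hB : volume B ≠ ∞)
    (hh : 0 ≤ h) (hr : h ≤ 2 * r) {v : ℝ} (hv : v ∈ Ioo 0 (volume.real A - h)) :
    cumul B (y v + r) - cumul B (y (v + h) - r) ≤ 2 * r - h := by
  have h1 := hy.sub_le hA (v := v) (w := v + h) ⟨hv.1, by linarith [hv.2]⟩
    ⟨by linarith [hv.1], by linarith [hv.2]⟩ (by linarith)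
  rcases le_total (y (v + h) - r) (y v + r) with h2 | h2
  · have := cumul_sub_le hB h2
    linarith
  · have := cumul_mono hB h2
    linarith

theorem IsQuantile.windowOverlap_split (hy : IsQuantile A y) (hA : volume A ≠ ∞)
    (hB : volume B ≠ ∞) (hr0 : 0 ≤ r) (hh : 0 ≤ h) (hha : h ≤ volume.real A) :
    windowOverlap r A B = ENNReal.ofReal
      ((∫ v in (volume.real A - h)..volume.real A, cumul B (y v + r)) -
        (∫ v in 0..h, cumul B (y v - r)) +
          ∫ v in 0..(volume.real A - h), (cumul B (y v + r) - cumul B (y (v + h) - r))) := by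
  rw [windowOverlap_eq hy hA hB hr0]
  congr 1
  have := hy.intervalIntegrable hA hB (-r)
  simp only [← sub_eq_add_neg] at this
  exact integral_sub_split hh hha (hy.intervalIntegrable hA hB r) this

theorem IsQuantile.intervalIntegrable_window (hy : IsQuantile A y) (hA : volume A ≠ ∞)
    (hB : volume B ≠ ∞) (hh : 0 ≤ h) (hha : h ≤ volume.real A) (r : ℝ) :
    IntervalIntegrable (fun v => cumul B (y v + r) - cumul B (y (v + h) - r)) volume 0
      (volume.real A - h) := by
  have h1 := hy.intervalIntegrable hA hB r
  have h2 := hy.intervalIntegrable hA hB (-r)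
  simp only [← sub_eq_add_neg] at h2
  refine (h1.mono_set ?_).sub ?_
  · rw [uIcc_of_le (by linarith), uIcc_of_le (by linarith)]
    exact Icc_subset_Icc le_rfl (by linarith)
  · have h3 : IntervalIntegrable (fun v => cumul B (y v - r)) volume h (volume.real A) := by
      refine h2.mono_set ?_
      rw [uIcc_of_le (by linarith), uIcc_of_le (by linarith)]
      exact Icc_subset_Icc hh le_rfl
    simpa using h3.comp_add_right h

theorem IsQuantile.outer_le (hy : IsQuantile A y) (hA : volume A ≠ ∞) (hB : volume B ≠ ∞)
    (hh : 0 ≤ h) (hha : h ≤ volume.real A) :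
    (∫ v in (volume.real A - h)..volume.real A, cumul B (y v + r)) -
        (∫ v in 0..h, cumul B (y v - r)) ≤ h * volume.real B := by
  have h1 : ∫ v in (volume.real A - h)..volume.real A, cumul B (y v + r) ≤
      ∫ _ in (volume.real A - h)..volume.real A, volume.real B := by
    refine intervalIntegral.integral_mono_on_of_le_Ioo (by linarith) ?_ (by simp)
      fun _ _ => cumul_le hB _
    refine (hy.intervalIntegrable hA hB r).mono_set ?_
    rw [uIcc_of_le (by linarith), uIcc_of_le (by linarith)]
    exact Icc_subset_Icc (by linarith) le_rfl
  have h2 : 0 ≤ ∫ v in 0..h, cumul B (y v - r) :=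
    intervalIntegral.integral_nonneg hh fun _ _ => cumul_nonneg _ _
  rw [intervalIntegral.integral_const, smul_eq_mul] at h1
  have : volume.real A - (volume.real A - h) = h := by ring
  rw [this] at h1
  linarith

theorem windowOverlap_le (hA : volume A ≠ ∞) (hB : volume B ≠ ∞) (hr0 : 0 ≤ r)
    (hh : 0 ≤ h) (hha : h ≤ volume.real A) (hhr : h ≤ 2 * r) :
    windowOverlap r A B ≤
      ENNReal.ofReal (h * volume.real B + (volume.real A - h) * (2 * r - h)) := by
  obtain ⟨y, hy⟩ := exists_isQuantile hA
  rw [hy.windowOverlap_split hA hB hr0 hh hha]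
  refine ENNReal.ofReal_le_ofReal (add_le_add (hy.outer_le hA hB hh hha) ?_)
  have := intervalIntegral.integral_mono_on_of_le_Ioo (by linarith)
    (hy.intervalIntegrable_window hA hB hh hha r)
    (intervalIntegrable_const (c := 2 * r - h)) fun v hv => hy.cumul_window_le hA hB hh hhr hv
  rwa [intervalIntegral.integral_const, smul_eq_mul, sub_zero] at this

/-- Equality in `windowOverlap_le` forces all the windows to be filled. -/
theorem IsQuantile.ae_window_eq (hy : IsQuantile A y) (hA : volume A ≠ ∞) (hB : volume B ≠ ∞)
    (hr0 : 0 ≤ r) (hh : 0 ≤ h) (hha' : h < volume.real A) (hhr' : h < 2 * r)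
    (heq : ENNReal.ofReal (h * volume.real B + (volume.real A - h) * (2 * r - h)) ≤
      windowOverlap r A B) :
    ∀ᵐ v, v ∈ Ioo 0 (volume.real A - h) →
      cumul B (y v + r) - cumul B (y (v + h) - r) = 2 * r - h := by
  have hha := hha'.le
  have hhr := hhr'.le
  have hpos : 0 < (volume.real A - h) * (2 * r - h) :=
    mul_pos (by linarith) (by linarith)
  have hout := hy.outer_le hA hB hh hha (r := r)
  have hint := hy.intervalIntegrable_window hA hB hh hha r
  have hmono : ∫ v in 0..(volume.real A - h), (cumul B (y v + r) - cumul B (y (v + h) - r)) ≤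
      ∫ v in 0..(volume.real A - h), (2 * r - h) :=
    intervalIntegral.integral_mono_on_of_le_Ioo (by linarith) hint
      (intervalIntegrable_const (c := 2 * r - h)) fun v hv => hy.cumul_window_le hA hB hh hhr hv
  have hconst : ∫ v in 0..(volume.real A - h), (2 * r - h) =
      (volume.real A - h) * (2 * r - h) := by
    rw [intervalIntegral.integral_const, smul_eq_mul, sub_zero]
  have hfin : (volume.real A - h) * (2 * r - h) ≤
      ∫ v in 0..(volume.real A - h), (cumul B (y v + r) - cumul B (y (v + h) - r)) := by
    rw [hy.windowOverlap_split hA hB hr0 hh hha] at heq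
    have hb : 0 ≤ h * volume.real B := mul_nonneg hh measureReal_nonneg
    -- The second alternative, a non-positive bound, is excluded by `hpos`.
    rcases ENNReal.ofReal_le_ofReal_iff'.1 heq with h1 | h1
    · linarith
    · linarith
  have heq2 : ∫ v in 0..(volume.real A - h), (cumul B (y v + r) - cumul B (y (v + h) - r)) =
      ∫ v in 0..(volume.real A - h), (2 * r - h) := by linarith
  rw [intervalIntegral.integral_of_le (by linarith), intervalIntegral.integral_of_le (by linarith),
    integral_Ioc_eq_integral_Ioo, integral_Ioc_eq_integral_Ioo, integral_eq_iff_of_ae_le] at heq2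
  · exact (ae_restrict_iff' measurableSet_Ioo).1 heq2
  · exact (intervalIntegrable_iff_integrableOn_Ioo_of_le (by linarith)).1 hint
  · exact (intervalIntegrable_iff_integrableOn_Ioo_of_le (by linarith)).1 intervalIntegrable_const
  · exact (ae_restrict_iff' measurableSet_Ioo).2
      (Filter.Eventually.of_forall fun v hv => hy.cumul_window_le hA hB hh hhr hv)

end Window

theorem cumul_Ioo {β : ℝ} (hβ : 0 ≤ β) (t : ℝ) :
    cumul (Ioo (-β) β) t = max 0 (min (t + β) (2 * β)) := by
  have : (Ioo (-β) β ∩ Iic t : Set ℝ) =ᵐ[volume] Ioc (-β) (min β t) := by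
    have : Ioc (-β) (min β t) = Ioc (-β) β ∩ Iic t := by
      ext x; simp only [mem_Ioc, le_min_iff, mem_inter_iff, mem_Iic]; tauto
    rw [this]
    exact Ioo_ae_eq_Ioc.inter (Filter.EventuallyEq.refl _ _)
  rw [cumul, measureReal_congr this, Measure.real, Real.volume_Ioc]
  rcases le_total β t with h | h
  · rw [min_eq_left h, min_eq_right (by linarith), ENNReal.toReal_ofReal (by linarith),
      max_eq_right (by linarith)]
    ring
  · rw [min_eq_right h, min_eq_left (by linarith), ENNReal.toReal_ofReal', max_comm]
    ring_nf

theorem volume_real_Ioo_symm {α : ℝ} (hα : 0 ≤ α) : volume.real (Ioo (-α) α) = 2 * α := by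
  rw [Measure.real, Real.volume_Ioo, ENNReal.toReal_ofReal (by linarith)]
  ring

theorem isQuantile_Ioo {α : ℝ} (hα : 0 ≤ α) : IsQuantile (Ioo (-α) α) (fun v => v - α) := by
  intro v hv
  rw [volume_real_Ioo_symm hα] at hv
  rw [cumul_Ioo hα, sub_add_cancel, min_eq_left hv.2.le, max_eq_right hv.1.le]

/-- For centred intervals every estimate behind `windowOverlap_le` is sharp. Condition `h1` pushes
the shifted end pieces beyond `±β`, where the distribution function is saturated. Condition `h2`
keeps the paired windows inside `(-β, β)`, unless the paired integral has empty domain or its bound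
`2 * r - h` is zero. -/
theorem le_windowOverlap_Ioo {α β r h : ℝ} (hα : 0 ≤ α) (hβ : 0 ≤ β) (hr : 0 ≤ r) (hh : 0 ≤ h)
    (hha : h ≤ 2 * α) (hhr : h ≤ 2 * r) (h1 : h = 0 ∨ h ≤ α - β + r)
    (h2 : h = 2 * α ∨ h = 2 * r ∨ α - β + r ≤ h) :
    ENNReal.ofReal (h * (2 * β) + (2 * α - h) * (2 * r - h)) ≤
      windowOverlap r (Ioo (-α) α) (Ioo (-β) β) := by
  have hy := isQuantile_Ioo hα
  have hA : volume (Ioo (-α) α) ≠ ∞ := by simp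
  have hB : volume (Ioo (-β) β) ≠ ∞ := by simp
  have hr2 := volume_real_Ioo_symm hα
  have hint := hy.intervalIntegrable_window hA hB hh (by rwa [hr2]) r
  rw [hy.windowOverlap_split hA hB hr hh (by rwa [hr2]), hr2]
  rw [hr2] at hint
  refine ENNReal.ofReal_le_ofReal ?_
  have e1 : ∫ v in (2 * α - h)..(2 * α), cumul (Ioo (-β) β) (v - α + r) = h * (2 * β) := by
    rcases h1 with h1 | h1
    · simp [h1]
    · rw [intervalIntegral.integral_congr (g := fun _ => 2 * β)]
      · rw [intervalIntegral.integral_const, smul_eq_mul]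
        ring
      · intro v hv
        rw [uIcc_of_le (by linarith)] at hv
        simp only [cumul_Ioo hβ]
        rw [min_eq_right (by linarith [hv.1]), max_eq_right (by linarith)]
  have e2 : ∫ v in (0)..h, cumul (Ioo (-β) β) (v - α - r) = 0 := by
    rcases h1 with h1 | h1
    · simp [h1]
    · rw [intervalIntegral.integral_congr (g := fun _ => 0)]
      · simp
      · intro v hv
        rw [uIcc_of_le hh] at hv
        simp only [cumul_Ioo hβ]
        exact max_eq_left ((min_le_left _ _).trans (by linarith [hv.2]))
  have e3 : (2 * α - h) * (2 * r - h) ≤ ∫ v in (0)..(2 * α - h),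
      (cumul (Ioo (-β) β) (v - α + r) - cumul (Ioo (-β) β) (v + h - α - r)) := by
    have : ∫ v in (0)..(2 * α - h), (2 * r - h) ≤ ∫ v in (0)..(2 * α - h),
        (cumul (Ioo (-β) β) (v - α + r) - cumul (Ioo (-β) β) (v + h - α - r)) := by
      refine intervalIntegral.integral_mono_on_of_le_Ioo (by linarith)
        intervalIntegrable_const hint fun v hv => ?_
      rcases h2 with h2 | h2 | h2
      · exact absurd hv.1 (by linarith [hv.2])
      · have := cumul_mono hB (show v + h - α - r ≤ v - α + r by linarith)
        linarith
      · rw [cumul_Ioo hβ, cumul_Ioo hβ, min_eq_left (by linarith [hv.2]),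
          min_eq_left (by linarith [hv.2]), max_eq_right (by linarith [hv.1]),
          max_eq_right (by linarith [hv.1])]
        linarith
    rwa [intervalIntegral.integral_const, smul_eq_mul, sub_zero] at this
  rw [e1, e2]
  linarith

/-- Riesz's rearrangement inequality on the line for the kernel `1_{(-r, r)}`. -/
theorem windowOverlap_le_Ioo {A B : Set ℝ} (hA : volume A ≠ ∞) (hB : volume B ≠ ∞) {r : ℝ}
    (hr : 0 ≤ r) :
    windowOverlap r A B ≤ windowOverlap r
      (Ioo (-(volume.real A / 2)) (volume.real A / 2))
      (Ioo (-(volume.real B / 2)) (volume.real B / 2)) := by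
  have ha : 0 ≤ volume.real A := measureReal_nonneg
  have hb : 0 ≤ volume.real B := measureReal_nonneg
  obtain ⟨h, hh, hha, hhr, h1, h2⟩ : ∃ h : ℝ, 0 ≤ h ∧ h ≤ volume.real A ∧ h ≤ 2 * r ∧
      (h = 0 ∨ h ≤ volume.real A / 2 - volume.real B / 2 + r) ∧
      (h = volume.real A ∨ h = 2 * r ∨ volume.real A / 2 - volume.real B / 2 + r ≤ h) := by
    -- The optimal shift is `x`, clipped to the admissible range from `0` to `min (volume.real A) (2
    -- * r)`.
    set x := volume.real A / 2 - volume.real B / 2 + r with hx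
    rcases le_total x 0 with h0 | h0
    · exact ⟨0, le_rfl, ha, by linarith, Or.inl rfl, Or.inr (Or.inr h0)⟩
    · refine ⟨min x (min (volume.real A) (2 * r)), le_min h0 (le_min ha (by linarith)),
        (min_le_right _ _).trans (min_le_left _ _), (min_le_right _ _).trans (min_le_right _ _),
        Or.inr (min_le_left _ _), ?_⟩
      rcases min_choice x (min (volume.real A) (2 * r)) with h | h
      · exact Or.inr (Or.inr h.ge)
      · rcases min_choice (volume.real A) (2 * r) with h' | h'
        · exact Or.inl (h.trans h')
        · exact Or.inr (Or.inl (h.trans h'))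
  refine (windowOverlap_le hA hB hr hh hha hhr).trans ?_
  have := le_windowOverlap_Ioo (α := volume.real A / 2) (β := volume.real B / 2) (by positivity)
    (by positivity) hr hh (by linarith) hhr h1
    (by rcases h2 with h | h | h
        · left; linarith
        · right; left; exact h
        · right; right; exact h)
  simpa [mul_div_cancel₀] using this

/-! ### The equality case for the indicator of an interval -/

/-- A monotone function repeating its values after a step `δ` is constant. -/
theorem MonotoneOn.eq_of_ae_shift_eq {Z : ℝ → ℝ} {ℓ δ : ℝ} (hℓ : 0 < ℓ) (hδ : 0 < δ)
    (hZ : MonotoneOn Z (Ioo 0 (ℓ + δ)))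
    (h : ∀ᵐ v, v ∈ Ioo 0 ℓ → Z (v + δ) = Z v) {v w : ℝ}
    (hv : v ∈ Ioo 0 (ℓ + δ)) (hw : w ∈ Ioo 0 (ℓ + δ)) : Z v = Z w := by
  have hloc : ∀ x ∈ Ioo 0 (ℓ + δ), HasDerivAt Z 0 x := by
    intro x hx
    -- Each `x` lies in some `(u, u + δ)` with `Z (u + δ) = Z u`. By monotonicity `Z` is flat there,
    -- so its derivative vanishes at `x`.
    have hlt : max 0 (x - δ) < min x ℓ :=
      max_lt (lt_min hx.1 hℓ) (lt_min (by linarith) (by linarith [hx.2]))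
    obtain ⟨u, hu, hu'⟩ : ∃ u ∈ Ioo (max 0 (x - δ)) (min x ℓ), Z (u + δ) = Z u := by
      by_contra! hcon
      have : volume (Ioo (max 0 (x - δ)) (min x ℓ)) = 0 := by
        refine measure_mono_null (fun u hu => ?_) (ae_iff.1 h)
        have h1 : u ∈ Ioo 0 ℓ :=
          ⟨(le_max_left _ _).trans_lt hu.1, hu.2.trans_le (min_le_right _ _)⟩
        simpa [h1.1, h1.2] using hcon u hu
      rw [Real.volume_Ioo, ENNReal.ofReal_eq_zero] at this
      linarith
    have hu1 : 0 < u := (le_max_left _ _).trans_lt hu.1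
    have hu2 : x - δ < u := (le_max_right _ _).trans_lt hu.1
    have hu3 : u < x := hu.2.trans_le (min_le_left _ _)
    have hu4 : u < ℓ := hu.2.trans_le (min_le_right _ _)
    have hcst : ∀ z ∈ Ioo u (u + δ), Z z = Z u := fun z hz => by
      have hz' : z ∈ Ioo 0 (ℓ + δ) := ⟨hu1.trans hz.1, by linarith [hz.2]⟩
      have hu5 : u ∈ Ioo 0 (ℓ + δ) := ⟨hu1, by linarith⟩
      have hu6 : u + δ ∈ Ioo 0 (ℓ + δ) := ⟨by linarith, by linarith⟩
      exact le_antisymm (hu' ▸ hZ hz' hu6 hz.2.le) (hZ hu5 hz' hz.1.le)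
    refine (hasDerivAt_const x (Z u)).congr_of_eventuallyEq ?_
    filter_upwards [Ioo_mem_nhds hu3 (by linarith : x < u + δ)] with z hz using hcst z hz
  refine isOpen_Ioo.is_const_of_deriv_eq_zero isPreconnected_Ioo
    (fun x hx => (hloc x hx).differentiableAt.differentiableWithinAt)
    (fun x hx => (hloc x hx).deriv) hv hw

/-- Where the distribution function grows at unit speed the set has full measure. Since `(p, q)`
already has the length of `B`, nothing of `B` is left outside it. -/
theorem ae_eq_Ioo_of_cumul_sub_const {B : Set ℝ} (hB : volume B ≠ ∞) (hBm : MeasurableSet B)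
    {p q : ℝ} (hpq : q - p = volume.real B)
    (h : ∀ s ∈ Ioo p q, ∀ t ∈ Ioo p q, cumul B t - t = cumul B s - s) :
    B =ᵐ[volume] Ioo p q := by
  have hle : q - p ≤ volume.real (B ∩ Ioo p q) := by
    refine le_of_forall_pos_lt_add fun ε hε => ?_
    rcases lt_or_ge (q - p) ε with h1 | h1
    · exact h1.trans_le (by simp)
    · have hs : p + ε / 4 ∈ Ioo p q := ⟨by linarith, by linarith⟩
      have ht : q - ε / 4 ∈ Ioo p q := ⟨by linarith, by linarith⟩
      have h2 := h _ hs _ ht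
      have h3 := cumul_sub hB (show p + ε / 4 ≤ q - ε / 4 by linarith)
      have h4 : volume.real (B ∩ Ioc (p + ε / 4) (q - ε / 4)) ≤ volume.real (B ∩ Ioo p q) :=
        measureReal_mono (inter_subset_inter_right _ fun x hx =>
          ⟨by linarith [hx.1], by linarith [hx.2]⟩) (measure_ne_top_of_subset inter_subset_left hB)
      linarith
  have hfin : volume (B ∩ Ioo p q) ≠ ∞ := measure_ne_top_of_subset inter_subset_left hB
  have hm : MeasurableSet (B ∩ Ioo p q) := hBm.inter measurableSet_Ioo
  have h1 : (B ∩ Ioo p q : Set ℝ) =ᵐ[volume] B := by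
    refine ae_eq_of_subset_of_measure_ge inter_subset_left ?_ hm.nullMeasurableSet hB
    rw [← ofReal_measureReal hB, ← ofReal_measureReal hfin]
    exact ENNReal.ofReal_le_ofReal (hpq ▸ hle)
  have h2 : (B ∩ Ioo p q : Set ℝ) =ᵐ[volume] Ioo p q := by
    refine ae_eq_of_subset_of_measure_ge inter_subset_right ?_ hm.nullMeasurableSet (by simp)
    rw [Real.volume_Ioo, ← ofReal_measureReal hfin]
    exact ENNReal.ofReal_le_ofReal hle
  exact h1.symm.trans h2

/-- The equality case of Riesz's inequality on the line for the kernel `1_{(-r, r)}`. -/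
theorem exists_equivIntervalAround_of_windowOverlap {A B : Set ℝ} (hA : volume A ≠ ∞)
    (hB : volume B ≠ ∞) (hAm : MeasurableSet A) (hBm : MeasurableSet B) {r : ℝ}
    (hr1 : |volume.real A / 2 - volume.real B / 2| < r)
    (hr2 : r < volume.real A / 2 + volume.real B / 2)
    (heq : windowOverlap r
      (Ioo (-(volume.real A / 2)) (volume.real A / 2))
      (Ioo (-(volume.real B / 2)) (volume.real B / 2)) ≤ windowOverlap r A B) :
    ∃ c, EquivIntervalAround A c ∧ EquivIntervalAround B c := by
  obtain ⟨hr1a, hr1b⟩ := abs_lt.1 hr1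
  have ha : 0 ≤ volume.real A := measureReal_nonneg
  have hb : 0 ≤ volume.real B := measureReal_nonneg
  have hr : 0 ≤ r := (abs_nonneg _).trans hr1.le
  obtain ⟨y, hy⟩ := exists_isQuantile hA
  -- The assumptions on `r` say exactly that the optimal shift needs no clipping: `0 < h`, `h < |A|`
  -- and `h < 2r`.
  obtain ⟨h, hh⟩ : ∃ h, h = volume.real A / 2 - volume.real B / 2 + r := ⟨_, rfl⟩
  set a := volume.real A with ha'
  set b := volume.real B with hb'
  have hval := le_windowOverlap_Ioo (α := a / 2) (β := b / 2) (r := r) (h := h) (by positivity)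
    (by positivity) hr (by linarith) (by linarith) (by linarith) (Or.inr hh.le)
    (Or.inr (Or.inr hh.ge))
  rw [mul_div_cancel₀ _ two_ne_zero, mul_div_cancel₀ _ two_ne_zero] at hval
  have hae := hy.ae_window_eq hA hB hr (by linarith) (by linarith) (by linarith) (hval.trans heq)
  rw [← ha'] at hae
  -- A filled window must have the maximal length `2 * r - h`, which leaves no slack in `y (v + h) -
  -- y v ≥ h`.
  have hyv : ∀ᵐ v, v ∈ Ioo 0 (a - h) → y (v + h) - y v = h := by
    filter_upwards [hae] with v hv hv'
    have h1 := hv hv'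
    have h2 := hy.sub_le hA (v := v) (w := v + h) ⟨hv'.1, by linarith [hv'.2]⟩
      ⟨by linarith [hv'.1], by linarith [hv'.2]⟩ (by linarith)
    rcases le_total (y (v + h) - r) (y v + r) with h3 | h3
    · have := cumul_sub_le hB h3
      linarith
    · have := cumul_mono hB h3
      linarith
  -- The function `y v - v` is non-decreasing and repeats after the step `h`, hence is constant, and
  -- `A` is an interval.
  have hconst : ∀ v ∈ Ioo 0 a, ∀ w ∈ Ioo 0 a, y v - v = y w - w := by
    intro v hv w hw
    refine MonotoneOn.eq_of_ae_shift_eq (Z := fun v => y v - v) (ℓ := a - h) (δ := h) (by linarith)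
      (by linarith)
      ?_ ?_ (by simpa using hv) (by simpa using hw)
    · intro v hv w hw hvw
      rw [sub_add_cancel] at hv hw
      have := hy.sub_le hA hv hw hvw
      simp only
      linarith
    · filter_upwards [hyv] with v hv hv'
      have := hv hv'
      linarith
  have hapos : 0 < a := by linarith
  obtain ⟨y₀, hy₀⟩ : ∃ y₀, ∀ v ∈ Ioo 0 a, y v = y₀ + v :=
    ⟨y (a / 2) - a / 2, fun v hv => by
      have := hconst v hv (a / 2) ⟨by linarith, by linarith⟩
      linarith⟩
  have hAI : A =ᵐ[volume] Ioo y₀ (y₀ + a) := by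
    refine ae_eq_Ioo_of_cumul_sub_const hA hAm (by simp [ha']) ?_
    have key : ∀ s ∈ Ioo y₀ (y₀ + a), cumul A s - s = - y₀ := fun s hs => by
      have h1 : s - y₀ ∈ Ioo 0 a := ⟨by linarith [hs.1], by linarith [hs.2]⟩
      have h2 := hy _ h1
      rw [hy₀ _ h1, add_sub_cancel] at h2
      linarith
    intro s hs t ht
    rw [key s hs, key t ht]
  -- Now `y v = y₀ + v`, and the filled windows from `y₀ + v + h - r` to `y₀ + v + r` have length `2
  -- * r - h`. So the monotone function `t - cumul B t` repeats after the step `2 * r - h`. The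
  -- interval swept out has length `b` and the same midpoint `y₀ + a / 2` as `A`.
  have hBI : B =ᵐ[volume] Ioo (y₀ + h - r) (y₀ + (a - h) + r) := by
    refine ae_eq_Ioo_of_cumul_sub_const hB hBm (by linarith) ?_
    intro s hs t ht
    have := MonotoneOn.eq_of_ae_shift_eq (Z := fun v => (v + (y₀ + h - r)) -
      cumul B (v + (y₀ + h - r))) (ℓ := a - h)
      (δ := 2 * r - h) (v := s - (y₀ + h - r)) (w := t - (y₀ + h - r)) (by linarith) (by linarith)
      (fun v _ w _ hvw => by
        have := cumul_sub_le hB (show v + (y₀ + h - r) ≤ w + (y₀ + h - r) by linarith)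
        simp only
        linarith)
      (by
        filter_upwards [hae] with v hv hv'
        have h1 := hv hv'
        rw [hy₀ v ⟨hv'.1, by linarith [hv'.2]⟩,
          hy₀ (v + h) ⟨by linarith [hv'.1], by linarith [hv'.2]⟩] at h1
        have e1 : v + (2 * r - h) + (y₀ + h - r) = y₀ + v + r := by ring
        have e2 : v + (y₀ + h - r) = y₀ + (v + h) - r := by ring
        rw [e1, e2]
        linarith)
      ⟨by linarith [hs.1], by linarith [hs.2]⟩ ⟨by linarith [ht.1], by linarith [ht.2]⟩
    simp only [sub_add_cancel] at this
    linarith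
  refine ⟨y₀ + a / 2, ⟨a / 2, by linarith, ?_⟩, ⟨b / 2, by linarith, ?_⟩⟩
  · rw [show y₀ + a / 2 - a / 2 = y₀ by ring, show y₀ + a / 2 + a / 2 = y₀ + a by ring]
    exact hAI.trans Ioo_ae_eq_Icc
  · rw [show y₀ + a / 2 - b / 2 = y₀ + h - r by rw [hh]; ring,
      show y₀ + a / 2 + b / 2 = y₀ + (a - h) + r by rw [hh]; ring]
    exact hBI.trans Ioo_ae_eq_Icc

/-! ### Riesz's inequality for symmetric decreasing kernels -/

theorem schwarzSet_eq_Ioo {A : Set ℝ} (hA : volume A ≠ ∞) :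
    schwarzSet A = Ioo (-(volume.real A / 2)) (volume.real A / 2) := by
  ext t
  rw [schwarzSet, mem_ofPred_eq, ← ofReal_measureReal hA, ENNReal.ofReal_lt_ofReal_iff_of_nonneg
    (by positivity), mem_Ioo, ← abs_lt]
  constructor <;> intro h <;> linarith

theorem volume_schwarzSet {A : Set ℝ} (hA : volume A ≠ ∞) : volume (schwarzSet A) = volume A := by
  rw [schwarzSet_eq_Ioo hA, Real.volume_Ioo, ← ofReal_measureReal hA]
  congr 1
  ring

theorem schwarzSet_congr {A B : Set ℝ} (h : A =ᵐ[volume] B) : schwarzSet A = schwarzSet B := by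
  simp only [schwarzSet, measure_congr h]

theorem SymmDecreasing.ordConnected {κ : ℝ → ℝ} (hκ : SymmDecreasing κ) (l : ℝ) :
    OrdConnected {u | l < κ u} := by
  refine ⟨fun a ha b hb x hx => ?_⟩
  rcases le_total |a| |b| with h | h
  · refine lt_of_lt_of_le hb (hκ _ _ ?_)
    exact (abs_le_max_abs_abs hx.1 hx.2).trans (max_le h le_rfl)
  · refine lt_of_lt_of_le ha (hκ _ _ ?_)
    exact (abs_le_max_abs_abs hx.1 hx.2).trans (max_le le_rfl h)

theorem SymmDecreasing.measurable {κ : ℝ → ℝ} (hκ : SymmDecreasing κ) : Measurable κ :=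
  measurable_of_Ioi fun l => (hκ.ordConnected l).measurableSet

/-- If `u` is missing from the level set, monotonicity in `|u|` confines that set to `(-|u|, |u|)`,
which is too short when `u` lies in the interval on the left. -/
theorem SymmDecreasing.Ioo_subset {κ : ℝ → ℝ} (hκ : SymmDecreasing κ) {l : ℝ} :
    Ioo (-(volume.real {u | l < κ u} / 2)) (volume.real {u | l < κ u} / 2) ⊆ {u | l < κ u} := by
  intro u hu
  by_contra hcon
  have h1 : {u | l < κ u} ⊆ Ioo (-|u|) |u| := fun v hv => by
    rw [mem_Ioo, ← abs_lt]
    by_contra h2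
    exact hcon (lt_of_lt_of_le hv (hκ _ _ (not_lt.1 h2)))
  have h2 := measureReal_mono h1 (μ := volume) (by simp)
  rw [volume_real_Ioo_symm (abs_nonneg u)] at h2
  have := abs_lt.2 hu
  linarith

theorem SymmDecreasing.level_ae_eq {κ : ℝ → ℝ} (hκ : SymmDecreasing κ) {l : ℝ}
    (hl : volume {u | l < κ u} ≠ ∞) :
    {u | l < κ u} =ᵐ[volume]
      Ioo (-(volume.real {u | l < κ u} / 2)) (volume.real {u | l < κ u} / 2) := by
  refine (ae_eq_of_subset_of_measure_ge (hκ.Ioo_subset) ?_ measurableSet_Ioo.nullMeasurableSet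
    hl).symm
  rw [Real.volume_Ioo, ← ofReal_measureReal hl]
  refine ENNReal.ofReal_le_ofReal (by linarith)

/-- `κ` is a non-negative symmetric decreasing representative of the integrable kernel `w`. -/
structure IsSymmKernel (w : ℝ → ℝ≥0∞) (κ : ℝ → ℝ) : Prop where
  symm : SymmDecreasing κ
  nonneg : ∀ u, 0 ≤ κ u
  ae_eq : w =ᵐ[volume] fun u => ENNReal.ofReal (κ u)
  finite : ∫⁻ u, w u ≠ ∞

theorem overlap_congr_kernel {w w' : ℝ → ℝ≥0∞} (h : w =ᵐ[volume] w') (A B : Set ℝ) :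
    overlap w A B = overlap w' A B := by
  unfold overlap
  congr 1
  funext s
  exact lintegral_congr_ae (ae_restrict_of_ae
    ((Measure.measurePreserving_sub_left volume s).quasiMeasurePreserving.ae_eq_comp h))

theorem overlap_congr_set (w : ℝ → ℝ≥0∞) {A A' B B' : Set ℝ} (hA : A =ᵐ[volume] A')
    (hB : B =ᵐ[volume] B') : overlap w A B = overlap w A' B' := by
  unfold overlap
  rw [Measure.restrict_congr_set hA, Measure.restrict_congr_set hB]

theorem overlap_univ (w : ℝ → ℝ≥0∞) (A : Set ℝ) :
    overlap w A univ = volume A * ∫⁻ u, w u := by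
  unfold overlap
  simp only [Measure.restrict_univ, lintegral_sub_left_eq_self, lintegral_const,
    MeasurableSet.univ, Measure.restrict_apply, univ_inter]
  rw [mul_comm]

/-- This exchanges upper bounds for overlaps with `B` and lower bounds for overlaps with its
complement. -/
theorem overlap_add_compl {w : ℝ → ℝ≥0∞} (hw : Measurable w) (A : Set ℝ) {B : Set ℝ}
    (hB : MeasurableSet B) :
    overlap w A B + overlap w A Bᶜ = volume A * ∫⁻ u, w u := by
  have hm : Measurable fun s => ∫⁻ t in B, w (s - t) :=
    (hw.comp (measurable_fst.sub measurable_snd)).lintegral_prod_right'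
  rw [← overlap_univ]
  unfold overlap
  rw [← lintegral_add_left hm]
  simp only [lintegral_add_compl _ hB, Measure.restrict_univ]

theorem overlap_ne_top {w : ℝ → ℝ≥0∞} (hw : ∫⁻ u, w u ≠ ∞) {A : Set ℝ} (hA : volume A ≠ ∞)
    (B : Set ℝ) : overlap w A B ≠ ∞ := by
  refine ne_top_of_le_ne_top (ENNReal.mul_ne_top hA hw) ?_
  rw [← overlap_univ]
  exact lintegral_mono fun s => lintegral_mono' (Measure.restrict_mono (subset_univ _) le_rfl) le_rfl

namespace IsSymmKernel

variable {w : ℝ → ℝ≥0∞} {κ : ℝ → ℝ}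

theorem volume_level_ne_top (h : IsSymmKernel w κ) {l : ℝ} (hl : 0 < l) :
    volume {u | l < κ u} ≠ ∞ := by
  have h1 : ∫⁻ u, ENNReal.ofReal (κ u) ≠ ∞ := by
    rw [← lintegral_congr_ae h.ae_eq]
    exact h.finite
  refine ne_top_of_le_ne_top ?_ (measure_mono (μ := volume)
    (show {u | l < κ u} ⊆ {u | ENNReal.ofReal l ≤ ENNReal.ofReal (κ u)} from
      fun u hu => ENNReal.ofReal_le_ofReal (le_of_lt hu)))
  exact ne_top_of_le_ne_top (ENNReal.div_ne_top h1 (by simpa using hl))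
    (meas_ge_le_lintegral_div h.symm.measurable.ennreal_ofReal.aemeasurable (by simpa using hl)
      ENNReal.ofReal_ne_top)

/-- Layer cake in the kernel: `κ u` is the length of the set of levels `0 < l < κ u`, and each
superlevel set of `κ` is almost everywhere a centred window. -/
theorem overlap_eq_lintegral (h : IsSymmKernel w κ) (A B : Set ℝ) :
    overlap w A B =
      ∫⁻ l in Ioi (0 : ℝ), windowOverlap (volume.real {u | l < κ u} / 2) A B := by
  have hm : Measurable fun p : ℝ × ℝ => {p : ℝ × ℝ | p.1 < κ p.2}.indicator (1 : ℝ × ℝ → ℝ≥0∞) p :=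
    measurable_one.indicator (measurableSet_lt measurable_fst (h.symm.measurable.comp measurable_snd))
  have hk : ∀ u, ENNReal.ofReal (κ u) =
      ∫⁻ l in Ioi (0 : ℝ), {u | l < κ u}.indicator (1 : ℝ → ℝ≥0∞) u := fun u => by
    have : ∀ l, {u | l < κ u}.indicator (1 : ℝ → ℝ≥0∞) u = (Iio (κ u)).indicator 1 l :=
      fun l => by simp [indicator]
    simp_rw [this]
    rw [lintegral_indicator_one measurableSet_Iio, Measure.restrict_apply measurableSet_Iio,
      inter_comm, Ioi_inter_Iio, Real.volume_Ioo, sub_zero]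
  rw [overlap_congr_kernel h.ae_eq]
  unfold overlap
  simp_rw [hk]
  have e1 : ∀ s, ∫⁻ t in B, ∫⁻ l in Ioi (0 : ℝ), {u | l < κ u}.indicator (1 : ℝ → ℝ≥0∞) (s - t) =
      ∫⁻ l in Ioi (0 : ℝ), ∫⁻ t in B, {u | l < κ u}.indicator (1 : ℝ → ℝ≥0∞) (s - t) := fun s =>
    lintegral_lintegral_swap (hm.comp
      (measurable_snd.prodMk (measurable_const.sub measurable_fst))).aemeasurable
  simp_rw [e1]
  have hm3 : Measurable fun q : (ℝ × ℝ) × ℝ =>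
      {u | q.1.2 < κ u}.indicator (1 : ℝ → ℝ≥0∞) (q.1.1 - q.2) :=
    hm.comp (f := fun q : (ℝ × ℝ) × ℝ => (q.1.2, q.1.1 - q.2)) (by fun_prop)
  rw [lintegral_lintegral_swap hm3.lintegral_prod_right'.aemeasurable]
  refine setLIntegral_congr_fun measurableSet_Ioi fun l hl => ?_
  refine overlap_congr_kernel ?_ A B
  exact indicator_ae_eq_of_ae_eq_set (h.symm.level_ae_eq (h.volume_level_ne_top hl))

theorem windowOverlap_le_schwarzSet {A B : Set ℝ} (hA : volume A ≠ ∞) (hB : volume B ≠ ∞) (l : ℝ) :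
    windowOverlap (volume.real {u | l < κ u} / 2) A B ≤
      windowOverlap (volume.real {u | l < κ u} / 2) (schwarzSet A) (schwarzSet B) := by
  rw [schwarzSet_eq_Ioo hA, schwarzSet_eq_Ioo hB]
  exact windowOverlap_le_Ioo hA hB (by positivity)

/-- Riesz's rearrangement inequality on the line for a symmetric decreasing kernel. -/
theorem overlap_le (h : IsSymmKernel w κ) {A B : Set ℝ} (hA : volume A ≠ ∞)
    (hB : volume B ≠ ∞) : overlap w A B ≤ overlap w (schwarzSet A) (schwarzSet B) := by
  rw [h.overlap_eq_lintegral, h.overlap_eq_lintegral]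
  exact lintegral_mono fun l => windowOverlap_le_schwarzSet hA hB l

/-- The equality case of Riesz's rearrangement inequality for a strictly decreasing kernel. -/
theorem exists_equivIntervalAround (h : IsSymmKernel w κ) (hκ : StrictSymmDecreasing κ)
    {A B : Set ℝ} (hA : volume A ≠ ∞) (hB : volume B ≠ ∞) (hA0 : volume A ≠ 0)
    (hB0 : volume B ≠ 0) (hAm : MeasurableSet A) (hBm : MeasurableSet B)
    (heq : overlap w A B = overlap w (schwarzSet A) (schwarzSet B)) :
    ∃ c, EquivIntervalAround A c ∧ EquivIntervalAround B c := by
  have ha : 0 < volume.real A := ENNReal.toReal_pos hA0 hA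
  have hb : 0 < volume.real B := ENNReal.toReal_pos hB0 hB
  have hm : Measurable fun p : ℝ × ℝ => {p : ℝ × ℝ | p.1 < κ p.2}.indicator (1 : ℝ × ℝ → ℝ≥0∞) p :=
    measurable_one.indicator (measurableSet_lt measurable_fst (h.symm.measurable.comp measurable_snd))
  have hm3 : Measurable fun q : (ℝ × ℝ) × ℝ =>
      {u | q.1.1 < κ u}.indicator (1 : ℝ → ℝ≥0∞) (q.1.2 - q.2) :=
    hm.comp (f := fun q : (ℝ × ℝ) × ℝ => (q.1.1, q.1.2 - q.2)) (by fun_prop)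
  have hmeas : AEMeasurable (fun l => windowOverlap (volume.real {u | l < κ u} / 2)
      (schwarzSet A) (schwarzSet B)) (volume.restrict (Ioi 0)) := by
    have h1 : Measurable fun l => overlap ({u | l < κ u}.indicator 1) (schwarzSet A)
        (schwarzSet B) :=
      (hm3.lintegral_prod_right' (ν := volume.restrict (schwarzSet B))).lintegral_prod_right'
        (ν := volume.restrict (schwarzSet A))
    refine ⟨_, h1, ?_⟩
    refine (ae_restrict_iff' measurableSet_Ioi).2 (Filter.Eventually.of_forall fun l hl => ?_)
    exact (overlap_congr_kernel (indicator_ae_eq_of_ae_eq_set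
      (h.symm.level_ae_eq (h.volume_level_ne_top hl))) _ _).symm
  -- The window overlaps are ordered level by level and have equal finite integrals, so they agree
  -- for almost every level `l`.
  have hae := ae_eq_of_ae_le_of_lintegral_le (μ := volume.restrict (Ioi (0 : ℝ)))
    (f := fun l => windowOverlap (volume.real {u | l < κ u} / 2) A B)
    (g := fun l => windowOverlap (volume.real {u | l < κ u} / 2) (schwarzSet A) (schwarzSet B))
    (Filter.Eventually.of_forall fun l => windowOverlap_le_schwarzSet hA hB l)
    (by
      rw [← h.overlap_eq_lintegral]
      exact overlap_ne_top h.finite hA B) hmeas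
    (by rw [← h.overlap_eq_lintegral, ← h.overlap_eq_lintegral, heq])
  have hlt : |volume.real A / 2 - volume.real B / 2| < volume.real A / 2 + volume.real B / 2 :=
    abs_lt.2 ⟨by linarith, by linarith⟩
  -- Strict monotonicity makes `(κ r₂, κ r₁)` non-empty, so it contains a level with equality. The
  -- half-length of the level set of `κ` there lies between `r₁` and `r₂`, within the range of the
  -- window equality case.
  obtain ⟨r₁, h1, h1'⟩ := exists_between hlt
  obtain ⟨r₂, h2, h2'⟩ := exists_between h1'
  have hr₁ : 0 < r₁ := (abs_nonneg _).trans_lt h1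
  have hκlt : κ r₂ < κ r₁ := hκ.2 _ _ (by rwa [abs_of_pos hr₁, abs_of_pos (hr₁.trans h2)])
  rw [Filter.EventuallyEq, ae_restrict_iff' measurableSet_Ioi] at hae
  obtain ⟨l, hl, hle⟩ : ∃ l ∈ Ioo (κ r₂) (κ r₁),
      windowOverlap (volume.real {u | l < κ u} / 2) A B =
        windowOverlap (volume.real {u | l < κ u} / 2) (schwarzSet A) (schwarzSet B) := by
    by_contra! hcon
    have : volume (Ioo (κ r₂) (κ r₁)) = 0 := by
      refine measure_mono_null (fun l hl => ?_) (ae_iff.1 hae)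
      have h3 : 0 < l := (h.nonneg _).trans_lt hl.1
      simpa [h3] using hcon l hl
    rw [Real.volume_Ioo, ENNReal.ofReal_eq_zero] at this
    linarith
  have hfin := h.volume_level_ne_top ((h.nonneg _).trans_lt hl.1)
  have hlow : r₁ ≤ volume.real {u | l < κ u} / 2 := by
    have h3 : Ioo (-r₁) r₁ ⊆ {u | l < κ u} := fun u hu =>
      hl.2.trans_le (hκ.1 _ _ (by
        rw [abs_of_pos hr₁]
        exact (abs_lt.2 hu).le))
    have := measureReal_mono h3 (μ := volume) hfin
    rw [volume_real_Ioo_symm hr₁.le] at this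
    linarith
  have hup : volume.real {u | l < κ u} / 2 ≤ r₂ := by
    have h3 : {u | l < κ u} ⊆ Ioo (-r₂) r₂ := fun u hu => by
      rw [mem_Ioo, ← abs_lt]
      by_contra h4
      have := hκ.1 r₂ u (by rw [abs_of_pos (hr₁.trans h2)]; exact not_lt.1 h4)
      exact absurd (hu.trans_le this) (not_lt.2 hl.1.le)
    have := measureReal_mono h3 (μ := volume) (by simp)
    rw [volume_real_Ioo_symm (hr₁.trans h2).le] at this
    linarith
  rw [schwarzSet_eq_Ioo hA, schwarzSet_eq_Ioo hB] at hle
  exact exists_equivIntervalAround_of_windowOverlap hA hB hAm hBm (h1.trans_le hlow)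
    (hup.trans_lt h2') hle.ge

end IsSymmKernel

/-! ### Intervals with a common centre -/

theorem overlap_translate (w : ℝ → ℝ≥0∞) (A B : Set ℝ) (c : ℝ) :
    overlap w ((fun t => t - c) ⁻¹' A) ((fun t => t - c) ⁻¹' B) = overlap w A B := by
  unfold overlap
  have hmp := measurePreserving_sub_right (volume : Measure ℝ) c
  have hme : MeasurableEmbedding fun t : ℝ => t - c := measurableEmbedding_subRight c
  have h1 : ∀ s, ∫⁻ t in (fun t => t - c) ⁻¹' B, w (s - t) = ∫⁻ t in B, w (s - c - t) := fun s => by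
    simpa only [sub_sub_sub_cancel_right] using
      hmp.setLIntegral_comp_preimage_emb hme (fun t => w (s - c - t)) B
  simp_rw [h1]
  exact hmp.setLIntegral_comp_preimage_emb hme (fun s => ∫⁻ t in B, w (s - t)) A

theorem EquivIntervalAround.ae_eq_schwarzSet {A : Set ℝ} {c : ℝ} (h : EquivIntervalAround A c) :
    A =ᵐ[volume] (fun t => t - c) ⁻¹' schwarzSet A := by
  obtain ⟨r, hr, hA⟩ := h
  have hv : volume A = ENNReal.ofReal (2 * r) := by
    rw [measure_congr hA, Real.volume_Icc]
    congr 1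
    ring
  have hvr : volume.real A = 2 * r := by rw [Measure.real, hv, ENNReal.toReal_ofReal (by positivity)]
  rw [schwarzSet_eq_Ioo (by rw [hv]; exact ENNReal.ofReal_ne_top), hvr, preimage_sub_const_Ioo,
    show -(2 * r / 2) + c = c - r by ring, show 2 * r / 2 + c = c + r by ring]
  exact hA.trans Ioo_ae_eq_Icc.symm

theorem EquivIntervalAround.of_ae_eq_schwarzSet {A : Set ℝ} {c : ℝ} (hA : volume A ≠ ∞)
    (h : A =ᵐ[volume] (fun t => t - c) ⁻¹' schwarzSet A) : EquivIntervalAround A c := by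
  refine ⟨volume.real A / 2, by positivity, ?_⟩
  rw [schwarzSet_eq_Ioo hA, preimage_sub_const_Ioo, neg_add_eq_sub, add_comm _ c] at h
  exact h.trans Ioo_ae_eq_Icc

theorem overlap_eq_of_equivIntervalAround (w : ℝ → ℝ≥0∞) {A B : Set ℝ} {c : ℝ}
    (hAc : EquivIntervalAround A c) (hBc : EquivIntervalAround B c) :
    overlap w A B = overlap w (schwarzSet A) (schwarzSet B) := by
  rw [overlap_congr_set w hAc.ae_eq_schwarzSet hBc.ae_eq_schwarzSet, overlap_translate]

theorem overlap_eq_zero_left (w : ℝ → ℝ≥0∞) {A : Set ℝ} (hA : volume A = 0) (B : Set ℝ) :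
    overlap w A B = 0 := by
  unfold overlap
  rw [Measure.restrict_eq_zero.2 hA, lintegral_zero_measure]

theorem overlap_eq_zero_right (w : ℝ → ℝ≥0∞) (A : Set ℝ) {B : Set ℝ} (hB : volume B = 0) :
    overlap w A B = 0 := by
  unfold overlap
  simp [Measure.restrict_eq_zero.2 hB]

theorem equivIntervalAround_of_volume_eq_zero {A : Set ℝ} (hA : volume A = 0) (c : ℝ) :
    EquivIntervalAround A c :=
  ⟨0, le_rfl, by
    have h1 : A =ᵐ[volume] (∅ : Set ℝ) := ae_eq_empty.2 hA
    have h2 : Icc (c - 0) (c + 0) =ᵐ[volume] (∅ : Set ℝ) := ae_eq_empty.2 (by simp)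
    exact h1.trans h2.symm⟩

theorem EquivIntervalAround.congr {A B : Set ℝ} {c : ℝ} (h : EquivIntervalAround A c)
    (hAB : A =ᵐ[volume] B) : EquivIntervalAround B c :=
  let ⟨r, hr, h'⟩ := h
  ⟨r, hr, hAB.symm.trans h'⟩

/-- Almost equal intervals have equal lengths, and moving the centre would uncover an end piece.
Null sets must be excluded: the degenerate interval fits every centre. -/
theorem EquivIntervalAround.center_unique {A : Set ℝ} {c c' : ℝ} (hA : volume A ≠ 0)
    (h : EquivIntervalAround A c) (h' : EquivIntervalAround A c') : c = c' := by
  obtain ⟨r, hr, h⟩ := h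
  obtain ⟨r', hr', h'⟩ := h'
  have hI : Icc (c - r) (c + r) =ᵐ[volume] Icc (c' - r') (c' + r') := h.symm.trans h'
  have hv := measure_congr hI
  have hr0 : 0 < r := by
    rcases hr.eq_or_lt with h0 | h0
    · rw [measure_congr h, ← h0] at hA
      simp at hA
    · exact h0
  rw [Real.volume_Icc, Real.volume_Icc, ENNReal.ofReal_eq_ofReal_iff (by linarith) (by linarith)]
    at hv
  have hrr : r = r' := by linarith
  subst hrr
  have key : ∀ a b : ℝ, Icc (a - r) (a + r) =ᵐ[volume] Icc (b - r) (b + r) → b ≤ a := by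
    intro a b hab
    by_contra! hlt
    have h1 := (ae_eq_set.1 hab).1
    have h2 : Ico (a - r) (min (b - r) (a + r)) ⊆ Icc (a - r) (a + r) \ Icc (b - r) (b + r) :=
      fun x hx => ⟨⟨hx.1, (hx.2.trans_le (min_le_right _ _)).le⟩,
        fun h => absurd h.1 (not_le.2 (hx.2.trans_le (min_le_left _ _)))⟩
    have h3 := measure_mono_null h2 h1
    rw [Real.volume_Ico, ENNReal.ofReal_eq_zero] at h3
    have : a - r < min (b - r) (a + r) := lt_min (by linarith) (by linarith)
    linarith
  exact le_antisymm (key _ _ hI.symm) (key _ _ hI)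

/-! ### Convex functions as superpositions of ramps -/

/-- A non-negative convex function vanishing at `0` is, on `[0, ∞)`, a superposition of the
functions `t ↦ (t - s)₊` with `s ≥ 0`. -/
theorem ConvexOn.exists_measure_lintegral_eq {J : ℝ → ℝ} (hJ_nonneg : ∀ t, 0 ≤ J t)
    (hJ : ConvexOn ℝ univ J) (hJ0 : J 0 = 0) :
    ∃ ν : Measure ℝ, SFinite ν ∧ ν (Iio 0) = 0 ∧
      (∀ t, 0 ≤ t → ENNReal.ofReal (J t) = ∫⁻ s, ENNReal.ofReal (t - s) ∂ν) ∧
      (StrictConvexOn ℝ univ J → ∀ a b, 0 ≤ a → a < b → ν (Ioo a b) ≠ 0) := by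
  have hint : ∀ x : ℝ, x ∈ interior (univ : Set ℝ) := fun x => by simp
  obtain ⟨R, hR⟩ : ∃ R : ℝ → ℝ, R = fun x => derivWithin J (Ioi x) x := ⟨_, rfl⟩
  have hRd : ∀ x, HasDerivWithinAt J (R x) (Ioi x) x := fun x => by
    rw [hR]; exact hJ.hasDerivWithinAt_rightDeriv_of_mem_interior (hint x)
  have hRm : Monotone R := fun x y hxy => by
    rw [hR]; exact hJ.monotoneOn_rightDeriv (hint x) (hint y) hxy
  have hR0 : 0 ≤ R 0 := by
    rw [hR]
    simp only
    rw [hJ.rightDeriv_eq_sInf_slope_of_mem_interior (hint 0)]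
    refine Real.sInf_nonneg ?_
    rintro _ ⟨y, ⟨-, hy⟩, rfl⟩
    rw [slope_def_field, hJ0, sub_zero, sub_zero]
    exact div_nonneg (hJ_nonneg y) hy.le
  -- Cutting the right derivative off below `0` keeps it monotone, since `R 0 ≥ 0`. The slope of `J`
  -- at `0` becomes an atom of the Stieltjes measure there.
  obtain ⟨G, hG⟩ : ∃ G : ℝ → ℝ, G = fun u => if u < 0 then 0 else R u := ⟨_, rfl⟩
  have hGm : Monotone G := fun x y hxy => by
    rw [hG]
    simp only
    split_ifs with h1 h2 h2
    · exact le_rfl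
    · exact hR0.trans (hRm (not_lt.1 h2))
    · exact absurd (hxy.trans_lt h2) h1
    · exact hRm hxy
  have hGneg : ∀ u < 0, G u = 0 := fun u hu => by simp [hG, hu]
  have hGpos : ∀ u, 0 ≤ u → G u = R u := fun u hu => by simp [hG, not_lt.2 hu]
  obtain ⟨S, hS⟩ : ∃ S, S = hGm.stieltjesFunction := ⟨_, rfl⟩
  have hSlim : ∀ u, S u = Function.rightLim G u := fun u => by
    rw [hS]; exact hGm.stieltjesFunction_eq u
  have hGS : ∀ u, G u ≤ S u := fun u => by rw [hSlim]; exact hGm.le_rightLim le_rfl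
  have hSG : ∀ u v, u < v → S u ≤ G v := fun u v h => by rw [hSlim]; exact hGm.rightLim_le h
  have hSneg : ∀ u < 0, S u = 0 := fun u hu => by
    refine le_antisymm ?_ (by rw [← hGneg u hu]; exact hGS u)
    have := hSG u (u / 2) (by linarith)
    rwa [hGneg _ (by linarith)] at this
  -- `S` takes the right limits of `G`, so the two differ at most at the countably many
  -- discontinuities of `G`.
  have hae : ∀ᵐ u, S u = G u := by
    have h1 := hGm.countable_not_continuousAt
    have h2 : ∀ᵐ u, u ∉ {x | ¬ContinuousAt G x} := measure_eq_zero_iff_ae_notMem.1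
      (h1.measure_zero volume)
    filter_upwards [h2] with u hu
    rw [hSlim]
    exact (not_not.1 hu).continuousWithinAt.rightLim_eq
  have hbot : Filter.Tendsto S Filter.atBot (nhds 0) :=
    tendsto_const_nhds.congr' (by
      filter_upwards [Filter.eventually_lt_atBot (0 : ℝ)] with u hu using (hSneg u hu).symm)
  have hIic : ∀ u, S.measure (Iic u) = ENNReal.ofReal (S u) := fun u => by
    rw [S.measure_Iic hbot, sub_zero]
  have hnull : S.measure (Iio 0) = 0 := by
    have : (Iio (0 : ℝ)) ⊆ ⋃ n : ℕ, Iic (-(1 / ((n : ℝ) + 1))) := fun x hx => by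
      have hx' : 0 < -x := by linarith [mem_Iio.1 hx]
      obtain ⟨n, hn⟩ := exists_nat_one_div_lt hx'
      exact mem_iUnion.2 ⟨n, by rw [mem_Iic]; linarith⟩
    refine measure_mono_null this (measure_iUnion_null fun n => ?_)
    rw [hIic, hSneg _ (neg_lt_zero.2 (by positivity)), ENNReal.ofReal_zero]
  refine ⟨S.measure, inferInstance, hnull, fun t ht => ?_, fun hstrict a b ha hab => ?_⟩
  · have hRint : IntervalIntegrable R volume 0 t := hRm.intervalIntegrable
    have h1 : J t = ∫ u in (0)..t, R u := by
      rw [intervalIntegral.integral_eq_sub_of_hasDeriv_right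
        ((hJ.continuousOn isOpen_univ).mono (subset_univ _)) (fun x _ => hRd x) hRint, hJ0, sub_zero]
    rw [h1, intervalIntegral.integral_of_le ht, ofReal_integral_eq_lintegral_ofReal
      ((intervalIntegrable_iff_integrableOn_Ioc_of_le ht).1 hRint)
      ((ae_restrict_iff' measurableSet_Ioc).2 (Filter.Eventually.of_forall fun u hu =>
        hR0.trans (hRm hu.1.le)))]
    -- For almost every `u` in `(0, t]` the slope `R u` is the mass of `Iic u`. Exchanging the
    -- integrals replaces the condition `s ≤ u` by the length `(t - s)₊`.
    have h2 : ∫⁻ u in Ioc 0 t, ENNReal.ofReal (R u) =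
        ∫⁻ u in Ioc 0 t, ∫⁻ s, {p : ℝ × ℝ | p.2 ≤ p.1}.indicator 1 (u, s) ∂S.measure := by
      refine setLIntegral_congr_fun_ae measurableSet_Ioc ?_
      filter_upwards [hae] with u hu hu'
      have h3 : ∀ s, {p : ℝ × ℝ | p.2 ≤ p.1}.indicator (1 : ℝ × ℝ → ℝ≥0∞) (u, s) =
          (Iic u).indicator 1 s := fun s => by simp [indicator]
      simp_rw [h3]
      rw [lintegral_indicator_one measurableSet_Iic, hIic, hu, hGpos u hu'.1.le]
    have hm : Measurable ({p : ℝ × ℝ | p.2 ≤ p.1}.indicator (1 : ℝ × ℝ → ℝ≥0∞)) :=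
      measurable_one.indicator (measurableSet_le measurable_snd measurable_fst)
    rw [h2, lintegral_lintegral_swap (f := fun u s =>
      {p : ℝ × ℝ | p.2 ≤ p.1}.indicator (1 : ℝ × ℝ → ℝ≥0∞) (u, s)) hm.aemeasurable]
    refine lintegral_congr_ae ?_
    filter_upwards [measure_eq_zero_iff_ae_notMem.1 hnull] with s hs
    have hs0 : 0 ≤ s := not_lt.1 hs
    have h3 : ∀ u, {p : ℝ × ℝ | p.2 ≤ p.1}.indicator (1 : ℝ × ℝ → ℝ≥0∞) (u, s) =
        (Ici s).indicator 1 u := fun u => by simp [indicator]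
    simp_rw [h3]
    rw [lintegral_indicator_one measurableSet_Ici, Measure.restrict_apply measurableSet_Ici]
    have h4 : (Ici s ∩ Ioc 0 t : Set ℝ) =ᵐ[volume] Ioc s t := by
      have : Ioi s ∩ Ioc 0 t = Ioc s t := by
        ext x
        simp only [mem_inter_iff, mem_Ioi, mem_Ioc]
        exact ⟨fun h => ⟨h.1, h.2.2⟩, fun h => ⟨h.1, hs0.trans_lt h.1, h.2⟩⟩
      rw [← this]
      exact Ioi_ae_eq_Ici.symm.inter (Filter.EventuallyEq.refl _ _)
    rw [measure_congr h4, Real.volume_Ioc]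
  -- `S` and `R` can be compared only across a gap, hence three intermediate points: `S a₁ ≤ R a₂ <
  -- R a₃ ≤ S a₃`.
  · obtain ⟨a₁, h1, h1'⟩ := exists_between hab
    obtain ⟨a₂, h2, h2'⟩ := exists_between h1'
    obtain ⟨a₃, h3, h3'⟩ := exists_between h2'
    have hlt : R a₂ < R a₃ := by
      have e1 := hstrict.rightDeriv_lt_slope (mem_univ a₂) (mem_univ a₃) h3
        (hRd a₂).differentiableWithinAt
      have e2 := hJ.slope_le_leftDeriv_of_mem_interior (mem_univ a₂) (hint a₃) h3
      have e3 := hJ.leftDeriv_le_rightDeriv_of_mem_interior (hint a₃)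
      rw [hR]
      exact e1.trans_le (e2.trans e3)
    have hS : S a₁ < S a₃ := by
      have e1 := hSG a₁ a₂ h2
      have e2 := hGS a₃
      rw [hGpos _ (by linarith)] at e1 e2
      linarith
    refine ne_of_gt (lt_of_lt_of_le ?_ (measure_mono (show Ioc a₁ a₃ ⊆ Ioo a b from
      fun x hx => ⟨h1.trans hx.1, hx.2.trans_lt h3'⟩)))
    rw [S.measure_Ioc]
    exact ENNReal.ofReal_pos.2 (sub_pos.2 hS)

/-! ### Decomposition of the energy into one-dimensional overlaps -/

section Energy

variable {d : ℕ}

/-- The superlevel sets `{f > σ}` and `{g > τ}` are not both of positive measure, or almost all of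
their one-dimensional slices are intervals with one and the same centre. -/
def SharedCenter (f g : SplitSpace d → ℝ) (σ τ : ℝ) : Prop :=
  volume {x : SplitSpace d | σ < f x} = 0 ∨ volume {x : SplitSpace d | τ < g x} = 0 ∨
    ∃ c : ℝ, ∀ᵐ x' : EuclideanSpace ℝ (Fin d),
      EquivIntervalAround {t : ℝ | σ < f (x', t)} c ∧
        EquivIntervalAround {t : ℝ | τ < g (x', t)} c

theorem volume_superlevel_eq_zero_iff {f : SplitSpace d → ℝ} (hf : Measurable f) (σ : ℝ) :
    volume {x : SplitSpace d | σ < f x} = 0 ↔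
      ∀ᵐ x' : EuclideanSpace ℝ (Fin d), volume {t : ℝ | σ < f (x', t)} = 0 := by
  rw [Measure.volume_eq_prod, Measure.measure_prod_null (measurableSet_lt measurable_const hf)]
  rfl

theorem measurableSet_slice {f : SplitSpace d → ℝ} (hf : Measurable f) (σ : ℝ)
    (x' : EuclideanSpace ℝ (Fin d)) : MeasurableSet {t : ℝ | σ < f (x', t)} :=
  measurableSet_lt measurable_const (hf.comp measurable_prodMk_left)

/-- The hypothesis gives a centre depending on the pair of lines. Fixing one non-null slice of `{g >
τ}` fixes the centre of almost all slices of `{f > σ}`, because a non-null slice has only one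
centre. A non-null slice of `{f > σ}` then carries that centre over to `{g > τ}`. -/
theorem sharedCenter_of_ae {f g : SplitSpace d → ℝ} (hf : Measurable f) (hg : Measurable g)
    {σ τ : ℝ}
    (h : ∀ᵐ p : EuclideanSpace ℝ (Fin d) × EuclideanSpace ℝ (Fin d),
      volume {t : ℝ | σ < f (p.1, t)} ≠ 0 → volume {t : ℝ | τ < g (p.2, t)} ≠ 0 →
        ∃ c, EquivIntervalAround {t : ℝ | σ < f (p.1, t)} c ∧
          EquivIntervalAround {t : ℝ | τ < g (p.2, t)} c) :
    SharedCenter f g σ τ := by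
  by_cases hf0 : volume {x : SplitSpace d | σ < f x} = 0
  · exact Or.inl hf0
  by_cases hg0 : volume {x : SplitSpace d | τ < g x} = 0
  · exact Or.inr (Or.inl hg0)
  refine Or.inr (Or.inr ?_)
  rw [volume_superlevel_eq_zero_iff hf] at hf0
  rw [volume_superlevel_eq_zero_iff hg] at hg0
  have h1 := Measure.ae_ae_of_ae_prod h
  have h2 := Measure.ae_ae_of_ae_prod (Measure.measurePreserving_swap
    (μ := (volume : Measure (EuclideanSpace ℝ (Fin d))))
    (ν := (volume : Measure (EuclideanSpace ℝ (Fin d)))).quasiMeasurePreserving.ae h)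
  simp only [Prod.swap_prod_mk] at h1 h2
  have hf1 : ∃ᵐ x' : EuclideanSpace ℝ (Fin d), volume {t : ℝ | σ < f (x', t)} ≠ 0 :=
    Filter.not_eventually.1 hf0
  have hg1 : ∃ᵐ x' : EuclideanSpace ℝ (Fin d), volume {t : ℝ | τ < g (x', t)} ≠ 0 :=
    Filter.not_eventually.1 hg0
  obtain ⟨y₀, hy₀, hy₁⟩ := (hg1.and_eventually h2).exists
  obtain ⟨x₁, hx₁, hx₁'⟩ := (hf1.and_eventually hy₁).exists
  obtain ⟨c, -, hc⟩ := hx₁' hx₁ hy₀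
  have hF : ∀ᵐ x' : EuclideanSpace ℝ (Fin d), EquivIntervalAround {t : ℝ | σ < f (x', t)} c := by
    filter_upwards [hy₁] with x hx
    by_cases hx0 : volume {t : ℝ | σ < f (x, t)} = 0
    · exact equivIntervalAround_of_volume_eq_zero hx0 c
    · obtain ⟨c', h3, h4⟩ := hx hx0 hy₀
      rwa [hc.center_unique hy₀ h4]
  obtain ⟨x₀, hx₀, hx₂, hx₃⟩ := (hf1.and_eventually (h1.and hF)).exists
  refine ⟨c, hF.and ?_⟩
  filter_upwards [hx₂] with y hy
  by_cases hy0 : volume {t : ℝ | τ < g (y, t)} = 0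
  · exact equivIntervalAround_of_volume_eq_zero hy0 c
  · obtain ⟨c', h3, h4⟩ := hy hx₀ hy0
    rwa [hx₃.center_unique hx₀ h3]

theorem SharedCenter.ae_overlap_eq {f g : SplitSpace d → ℝ} (hf : Measurable f)
    (hg : Measurable g) {σ τ : ℝ} (h : SharedCenter f g σ τ)
    (w : SplitSpace d → ℝ≥0∞) :
    ∀ᵐ p : EuclideanSpace ℝ (Fin d) × EuclideanSpace ℝ (Fin d),
      overlap (fun u => w (p.1 - p.2, u)) {t : ℝ | σ < f (p.1, t)} {t : ℝ | τ < g (p.2, t)} =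
        overlap (fun u => w (p.1 - p.2, u)) (schwarzSet {t : ℝ | σ < f (p.1, t)})
          (schwarzSet {t : ℝ | τ < g (p.2, t)}) := by
  rw [Measure.volume_eq_prod]
  rcases h with h | h | ⟨c, h⟩
  · rw [volume_superlevel_eq_zero_iff hf] at h
    filter_upwards [Measure.quasiMeasurePreserving_fst.ae h] with p hp
    rw [overlap_eq_zero_left _ hp, overlap_eq_zero_left]
    rwa [volume_schwarzSet (by rw [hp]; simp)]
  · rw [volume_superlevel_eq_zero_iff hg] at h
    filter_upwards [Measure.quasiMeasurePreserving_snd.ae h] with p hp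
    rw [overlap_eq_zero_right _ _ hp, overlap_eq_zero_right]
    rwa [volume_schwarzSet (by rw [hp]; simp)]
  · filter_upwards [Measure.quasiMeasurePreserving_fst.ae h,
      Measure.quasiMeasurePreserving_snd.ae h] with p hp hp'
    exact overlap_eq_of_equivIntervalAround _ hp.1 hp'.2

/-- The energy of the one-sided profile `t ↦ ∫ (t - s)₊ dν(s)`. -/
noncomputable def layerEnergy (ν : Measure ℝ) (w : SplitSpace d → ℝ≥0∞) (f g : SplitSpace d → ℝ) :
    ℝ≥0∞ :=
  ∫⁻ x, ∫⁻ y, (∫⁻ s, ENNReal.ofReal (f x - g y - s) ∂ν) * w (x - y)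

/-- The contribution to `layerEnergy` of the levels `τ + s` of `f` and `τ` of `g` and of the lines
over `x'` and `y'`, at `(s, τ, x', y')`. -/
noncomputable def sliceEnergy (w : SplitSpace d → ℝ≥0∞) (f g : SplitSpace d → ℝ)
    (q : ℝ × ℝ × EuclideanSpace ℝ (Fin d) × EuclideanSpace ℝ (Fin d)) : ℝ≥0∞ :=
  overlap (fun u => w (q.2.2.1 - q.2.2.2, u)) {t : ℝ | q.2.1 + q.1 < f (q.2.2.1, t)}
    {t : ℝ | q.2.1 < g (q.2.2.2, t)}ᶜ

/-- The measure against which `sliceEnergy` integrates to `layerEnergy`. -/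
noncomputable def layerMeasure (d : ℕ) (ν : Measure ℝ) :
    Measure (ℝ × ℝ × EuclideanSpace ℝ (Fin d) × EuclideanSpace ℝ (Fin d)) :=
  ν.prod ((volume.restrict (Ioi (0 : ℝ))).prod volume)

/-- The integrand of `layerEnergy` after both layer-cake decompositions. -/
noncomputable def layerIntegrand (w : SplitSpace d → ℝ≥0∞) (f g : SplitSpace d → ℝ)
    (q : (ℝ × ℝ) × SplitSpace d × SplitSpace d) : ℝ≥0∞ :=
  {q : (ℝ × ℝ) × SplitSpace d × SplitSpace d |
    q.1.2 + q.1.1 < f q.2.1 ∧ g q.2.2 ≤ q.1.2}.indicator (fun q => w (q.2.1 - q.2.2)) q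

section

variable {w : SplitSpace d → ℝ≥0∞} {f g : SplitSpace d → ℝ}

theorem measurable_layerIntegrand (hw : Measurable w) (hf : Measurable f) (hg : Measurable g) :
    Measurable (layerIntegrand w f g) := by
  have h1 : MeasurableSet {q : (ℝ × ℝ) × SplitSpace d × SplitSpace d | q.1.2 + q.1.1 < f q.2.1} :=
    measurableSet_lt (by fun_prop) (by fun_prop)
  have h2 : MeasurableSet {q : (ℝ × ℝ) × SplitSpace d × SplitSpace d | g q.2.2 ≤ q.1.2} :=
    measurableSet_le (by fun_prop) (by fun_prop)
  exact Measurable.indicator (by fun_prop) (h1.inter h2)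

theorem sliceEnergy_eq (hf : Measurable f) (hg : Measurable g)
    (q : ℝ × ℝ × EuclideanSpace ℝ (Fin d) × EuclideanSpace ℝ (Fin d)) :
    sliceEnergy w f g q = ∫⁻ s, ∫⁻ t,
      layerIntegrand w f g ((q.1, q.2.1), (q.2.2.1, s), (q.2.2.2, t)) := by
  unfold sliceEnergy overlap
  rw [← lintegral_indicator (measurableSet_slice hf _ _)]
  congr 1
  funext s
  by_cases hs : q.2.1 + q.1 < f (q.2.2.1, s)
  · rw [indicator_of_mem (show s ∈ {t | q.2.1 + q.1 < f (q.2.2.1, t)} from hs), ← lintegral_indicator (measurableSet_slice hg _ _).compl]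
    congr 1
    funext t
    by_cases ht : g (q.2.2.2, t) ≤ q.2.1
    · rw [indicator_of_mem (by simpa using ht)]
      simp [layerIntegrand, hs, ht]
    · rw [indicator_of_notMem (by simpa using ht), layerIntegrand,
        indicator_of_notMem fun h => ht h.2]
  · rw [indicator_of_notMem (show s ∉ {t | q.2.1 + q.1 < f (q.2.2.1, t)} from hs)]
    simp [layerIntegrand, hs]

theorem measurable_sliceEnergy (hw : Measurable w) (hf : Measurable f) (hg : Measurable g) :
    Measurable (sliceEnergy w f g) := by
  rw [show sliceEnergy w f g = _ from funext (sliceEnergy_eq hf hg)]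
  have hm : Measurable fun z : ((ℝ × ℝ × EuclideanSpace ℝ (Fin d) × EuclideanSpace ℝ (Fin d)) × ℝ)
      × ℝ => layerIntegrand w f g ((z.1.1.1, z.1.1.2.1), (z.1.1.2.2.1, z.1.2),
        (z.1.1.2.2.2, z.2)) :=
    (measurable_layerIntegrand hw hf hg).comp (by fun_prop)
  exact hm.lintegral_prod_right'.lintegral_prod_right'

theorem measurableSet_layer (a b : ℝ) :
    MeasurableSet {m : ℝ × ℝ | m.2 + m.1 < a ∧ b ≤ m.2} := by
  have h1 : MeasurableSet {m : ℝ × ℝ | m.2 + m.1 < a} :=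
    measurableSet_lt (by fun_prop) (by fun_prop)
  have h2 : MeasurableSet {m : ℝ × ℝ | b ≤ m.2} := measurableSet_le (by fun_prop) (by fun_prop)
  exact h1.inter h2

/-- The ramp `(a - b - s)₊` is the length of `[b, a - s)`. As `b ≥ 0`, restricting `τ` to positive
values loses at most one point. -/
theorem lintegral_lintegral_layer (ν : Measure ℝ) [SFinite ν] {a b : ℝ} (hb : 0 ≤ b) :
    ∫⁻ s, ENNReal.ofReal (a - b - s) ∂ν =
      ∫⁻ m : ℝ × ℝ, {m : ℝ × ℝ | m.2 + m.1 < a ∧ b ≤ m.2}.indicator 1 m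
        ∂(ν.prod (volume.restrict (Ioi 0))) := by
  rw [lintegral_prod]
  · congr 1
    funext s
    have : ∀ τ, {m : ℝ × ℝ | m.2 + m.1 < a ∧ b ≤ m.2}.indicator (1 : ℝ × ℝ → ℝ≥0∞) (s, τ) =
        (Ico b (a - s)).indicator 1 τ := fun τ => by
      simp only [indicator, mem_ofPred_eq, mem_Ico]
      congr 1
      apply propext
      constructor <;> rintro ⟨h, h'⟩ <;> constructor <;> linarith
    simp_rw [this]
    rw [lintegral_indicator_one measurableSet_Ico, Measure.restrict_apply measurableSet_Ico]
    have h4 : (Ico b (a - s) ∩ Ioi 0 : Set ℝ) =ᵐ[volume] Ico b (a - s) := by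
      have : Ico b (a - s) ∩ Ici 0 = Ico b (a - s) :=
        inter_eq_left.2 fun x hx => hb.trans hx.1
      conv_rhs => rw [← this]
      exact (Filter.EventuallyEq.refl _ _).inter Ioi_ae_eq_Ici
    rw [measure_congr h4, Real.volume_Ico]
    ring_nf
  · exact (measurable_one.indicator (measurableSet_layer a b)).aemeasurable

theorem lintegral_lintegral_splitSpace {φ : SplitSpace d → SplitSpace d → ℝ≥0∞}
    (hφ : Measurable (Function.uncurry φ)) :
    ∫⁻ x, ∫⁻ y, φ x y = ∫⁻ p : EuclideanSpace ℝ (Fin d) × EuclideanSpace ℝ (Fin d),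
      ∫⁻ s, ∫⁻ t, φ (p.1, s) (p.2, t) := by
  have h1 : ∀ x, ∫⁻ y, φ x y = ∫⁻ y', ∫⁻ t, φ x (y', t) := fun x =>
    lintegral_prod _ (hφ.comp measurable_prodMk_left).aemeasurable
  have hm1 : Measurable fun x => ∫⁻ y', ∫⁻ t, φ x (y', t) := by
    simp_rw [← h1]
    exact hφ.lintegral_prod_right'
  have hm2 : Measurable fun z : ((EuclideanSpace ℝ (Fin d) × EuclideanSpace ℝ (Fin d)) × ℝ) × ℝ =>
      φ (z.1.1.1, z.1.2) (z.1.1.2, z.2) :=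
    hφ.comp (g := Function.uncurry φ) (f := fun z : ((EuclideanSpace ℝ (Fin d) ×
      EuclideanSpace ℝ (Fin d)) × ℝ) × ℝ => ((z.1.1.1, z.1.2), (z.1.1.2, z.2)))
      (by fun_prop)
  have hm3 : Measurable fun z : (EuclideanSpace ℝ (Fin d) × ℝ) × EuclideanSpace ℝ (Fin d) =>
      ∫⁻ t, φ z.1 (z.2, t) := by
    have : Measurable fun z : ((EuclideanSpace ℝ (Fin d) × ℝ) × EuclideanSpace ℝ (Fin d)) × ℝ =>
        φ z.1.1 (z.1.2, z.2) :=
      hφ.comp (g := Function.uncurry φ) (f := fun z : ((EuclideanSpace ℝ (Fin d) × ℝ) ×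
        EuclideanSpace ℝ (Fin d)) × ℝ => (z.1.1, (z.1.2, z.2))) (by fun_prop)
    exact this.lintegral_prod_right'
  simp_rw [h1]
  have h2 : ∫⁻ x, ∫⁻ y', ∫⁻ t, φ x (y', t) = ∫⁻ x', ∫⁻ s, ∫⁻ y', ∫⁻ t, φ (x', s) (y', t) :=
    lintegral_prod _ hm1.aemeasurable
  have h3 : (∫⁻ p : EuclideanSpace ℝ (Fin d) × EuclideanSpace ℝ (Fin d),
      ∫⁻ s, ∫⁻ t, φ (p.1, s) (p.2, t)) = ∫⁻ x', ∫⁻ y', ∫⁻ s, ∫⁻ t, φ (x', s) (y', t) :=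
    lintegral_prod _ hm2.lintegral_prod_right'.lintegral_prod_right'.aemeasurable
  rw [h2, h3]
  congr 1
  funext x'
  exact lintegral_lintegral_swap (hm3.comp (f := fun z : ℝ × EuclideanSpace ℝ (Fin d) =>
    ((x', z.1), z.2)) (by fun_prop)).aemeasurable

/-- The identity that makes the problem one-dimensional: for fixed levels and a fixed pair of lines
only an overlap of two subsets of `ℝ` remains. -/
theorem layerEnergy_eq (ν : Measure ℝ) [SFinite ν] (hw : Measurable w) (hf : Measurable f)
    (hg : Measurable g) (hg0 : ∀ x, 0 ≤ g x) :
    layerEnergy ν w f g = ∫⁻ q, sliceEnergy w f g q ∂(layerMeasure d ν) := by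
  have hm := measurable_layerIntegrand hw hf hg
  have h1 : ∀ x y, (∫⁻ s, ENNReal.ofReal (f x - g y - s) ∂ν) * w (x - y) =
      ∫⁻ m, layerIntegrand w f g (m, x, y) ∂(ν.prod (volume.restrict (Ioi 0))) := fun x y => by
    rw [lintegral_lintegral_layer ν (hg0 y), ← lintegral_mul_const _ (measurable_one.indicator
      (measurableSet_layer (f x) (g y)))]
    congr 1
    funext m
    simp only [layerIntegrand, indicator, mem_ofPred_eq]
    split_ifs <;> simp
  unfold layerEnergy
  simp_rw [h1]
  have hm1 : Measurable fun z : SplitSpace d × SplitSpace d =>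
      ∫⁻ m, layerIntegrand w f g (m, z.1, z.2) ∂(ν.prod (volume.restrict (Ioi 0))) :=
    (hm.comp measurable_swap).lintegral_prod_right'
  have hm2 : Measurable fun m : ℝ × ℝ => ∫⁻ z : SplitSpace d × SplitSpace d,
      layerIntegrand w f g (m, z.1, z.2) ∂(volume.prod volume) := hm.lintegral_prod_right'
  rw [← lintegral_prod (μ := volume) (ν := volume) _ hm1.aemeasurable,
    lintegral_lintegral_swap (f := fun (z : SplitSpace d × SplitSpace d) (m : ℝ × ℝ) =>
      layerIntegrand w f g (m, z.1, z.2)) (hm.comp measurable_swap).aemeasurable]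
  have hms := measurable_sliceEnergy hw hf hg
  have hms1 : ∀ s, Measurable fun r => sliceEnergy w f g (s, r) :=
    fun s => hms.comp measurable_prodMk_left
  rw [layerMeasure, lintegral_prod _ hms.aemeasurable, lintegral_prod _ hm2.aemeasurable]
  congr 1
  funext s
  rw [lintegral_prod _ (hms1 s).aemeasurable]
  congr 1
  funext τ
  have hm3 : Measurable fun z : SplitSpace d × SplitSpace d =>
      layerIntegrand w f g ((s, τ), z.1, z.2) := hm.comp measurable_prodMk_left
  rw [lintegral_prod _ hm3.aemeasurable]
  simp_rw [sliceEnergy_eq hf hg]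
  exact lintegral_lintegral_splitSpace hm3

end

/-! ### Comparison of layer energies under rearrangement -/

/-- The overlaps with `B` and with `Bᶜ` add up to the measure of `A` times the integral of `w`,
which is finite and unchanged by symmetrization. Riesz's inequality therefore reverses for
complements, with the same equality case. -/
theorem IsSymmKernel.overlap_compl_comparison {w : ℝ → ℝ≥0∞} {κ : ℝ → ℝ} (h : IsSymmKernel w κ)
    (hw : Measurable w) {A B A₁ B₁ : Set ℝ} (hB : MeasurableSet B)
    (hAfin : volume A ≠ ∞) (hBfin : volume B ≠ ∞) (hA₁ : A₁ =ᵐ[volume] schwarzSet A)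
    (hB₁ : B₁ =ᵐ[volume] schwarzSet B) :
    overlap w A₁ B₁ᶜ ≤ overlap w A Bᶜ ∧
      (overlap w A₁ B₁ᶜ = overlap w A Bᶜ ↔
        overlap w A B = overlap w (schwarzSet A) (schwarzSet B)) := by
  rw [overlap_congr_set w hA₁ hB₁.compl]
  have e1 := overlap_add_compl hw A hB
  have e2 := overlap_add_compl hw (schwarzSet A) (B := schwarzSet B)
    (by rw [schwarzSet_eq_Ioo hBfin]; exact measurableSet_Ioo)
  rw [volume_schwarzSet hAfin, ← e1] at e2
  have f1 := overlap_ne_top h.finite hAfin B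
  have f2 := overlap_ne_top h.finite (A := schwarzSet A) (by rwa [volume_schwarzSet hAfin])
    (schwarzSet B)
  have f3 := overlap_ne_top h.finite hAfin Bᶜ
  have hle := h.overlap_le hAfin hBfin
  refine ⟨?_, fun heq => ?_, fun heq => ?_⟩
  · refine (ENNReal.add_le_add_iff_left f2).1 ?_
    rw [e2]
    gcongr
  · rw [heq] at e2
    exact ((ENNReal.add_left_inj f3).1 e2).symm
  · rw [heq] at e2
    exact (ENNReal.add_right_inj f2).1 e2


/-- On almost every line the superlevel sets of `f₁` are the symmetrized superlevel sets of `f`. -/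
def IsRearrangement (f f₁ : SplitSpace d → ℝ) : Prop :=
  ∀ᵐ x' : EuclideanSpace ℝ (Fin d), ∀ τ : ℝ, 0 < τ →
    volume {t : ℝ | τ < f (x', t)} ≠ ∞ ∧
      {t : ℝ | τ < f₁ (x', t)} =ᵐ[volume] schwarzSet {t : ℝ | τ < f (x', t)}

section

variable {w : SplitSpace d → ℝ≥0∞} {f g f₁ g₁ : SplitSpace d → ℝ} {ν : Measure ℝ}

theorem ae_sub_of_ae {p : EuclideanSpace ℝ (Fin d) → Prop} (h : ∀ᵐ z, p z) :
    ∀ᵐ q : EuclideanSpace ℝ (Fin d) × EuclideanSpace ℝ (Fin d), p (q.1 - q.2) :=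
  (quasiMeasurePreserving_sub (volume : Measure (EuclideanSpace ℝ (Fin d))) volume).ae h

theorem ae_sliceEnergy_comparison [SFinite ν] (hν : ν (Iio 0) = 0) (hw : Measurable w)
    (hwk : ∀ᵐ z : EuclideanSpace ℝ (Fin d), ∃ κ, IsSymmKernel (fun u => w (z, u)) κ)
    (hg : Measurable g) (hf₁ : IsRearrangement f f₁)
    (hg₁ : IsRearrangement g g₁) :
    ∀ᵐ s ∂ν, ∀ τ, 0 < τ → ∀ᵐ p : EuclideanSpace ℝ (Fin d) × EuclideanSpace ℝ (Fin d),
      sliceEnergy w f₁ g₁ (s, τ, p) ≤ sliceEnergy w f g (s, τ, p) ∧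
      (sliceEnergy w f₁ g₁ (s, τ, p) = sliceEnergy w f g (s, τ, p) ↔
        overlap (fun u => w (p.1 - p.2, u)) {t : ℝ | τ + s < f (p.1, t)}
          {t : ℝ | τ < g (p.2, t)} =
        overlap (fun u => w (p.1 - p.2, u)) (schwarzSet {t : ℝ | τ + s < f (p.1, t)})
          (schwarzSet {t : ℝ | τ < g (p.2, t)})) := by
  have hfp : ∀ᵐ p : EuclideanSpace ℝ (Fin d) × EuclideanSpace ℝ (Fin d), ∀ τ : ℝ, 0 < τ →
      volume {t : ℝ | τ < f (p.1, t)} ≠ ∞ ∧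
        {t : ℝ | τ < f₁ (p.1, t)} =ᵐ[volume] schwarzSet {t : ℝ | τ < f (p.1, t)} :=
    Measure.quasiMeasurePreserving_fst.ae hf₁
  have hgp : ∀ᵐ p : EuclideanSpace ℝ (Fin d) × EuclideanSpace ℝ (Fin d), ∀ τ : ℝ, 0 < τ →
      volume {t : ℝ | τ < g (p.2, t)} ≠ ∞ ∧
        {t : ℝ | τ < g₁ (p.2, t)} =ᵐ[volume] schwarzSet {t : ℝ | τ < g (p.2, t)} :=
    Measure.quasiMeasurePreserving_snd.ae hg₁
  filter_upwards [measure_eq_zero_iff_ae_notMem.1 hν] with s hs τ hτ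
  -- Since `s ≥ 0` for `ν`-almost every `s`, the level `τ + s` is positive and the slice of `f`
  -- above it has finite measure.
  have hs0 : 0 ≤ s := not_lt.1 hs
  filter_upwards [hfp, hgp, ae_sub_of_ae hwk] with p hp1 hp2 ⟨κ, hκ⟩
  obtain ⟨h1, h2⟩ := hp1 (τ + s) (by linarith)
  obtain ⟨h3, h4⟩ := hp2 τ hτ
  exact hκ.overlap_compl_comparison (hw.comp measurable_prodMk_left)
    (measurableSet_slice hg _ _) h1 h3 h2 h4

theorem ae_layerMeasure_iff [SFinite ν]
    {P : ℝ × ℝ × EuclideanSpace ℝ (Fin d) × EuclideanSpace ℝ (Fin d) → Prop}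
    (hP : MeasurableSet {q | P q}) :
    (∀ᵐ q ∂(layerMeasure d ν), P q) ↔
      ∀ᵐ s ∂ν, ∀ᵐ τ : ℝ, 0 < τ →
        ∀ᵐ p : EuclideanSpace ℝ (Fin d) × EuclideanSpace ℝ (Fin d), P (s, τ, p) := by
  rw [layerMeasure, Measure.ae_prod_iff_ae_ae hP]
  refine Filter.eventually_congr (Filter.Eventually.of_forall fun s => ?_)
  rw [Measure.ae_prod_iff_ae_ae (p := fun r => P (s, r)) (measurable_prodMk_left hP),
    ae_restrict_iff' measurableSet_Ioi]
  rfl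

theorem layerEnergy_rearrangement_le [SFinite ν] (hν : ν (Iio 0) = 0) (hw : Measurable w)
    (hwk : ∀ᵐ z : EuclideanSpace ℝ (Fin d), ∃ κ, IsSymmKernel (fun u => w (z, u)) κ)
    (hf : Measurable f) (hg : Measurable g) (hfm : Measurable f₁) (hgm : Measurable g₁)
    (hg0 : ∀ x, 0 ≤ g x) (hg0' : ∀ x, 0 ≤ g₁ x)
    (hf₁ : IsRearrangement f f₁) (hg₁ : IsRearrangement g g₁) :
    layerEnergy ν w f₁ g₁ ≤ layerEnergy ν w f g := by
  rw [layerEnergy_eq ν hw hf hg hg0, layerEnergy_eq ν hw hfm hgm hg0']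
  refine lintegral_mono_ae ?_
  rw [ae_layerMeasure_iff (measurableSet_le (measurable_sliceEnergy hw hfm hgm)
    (measurable_sliceEnergy hw hf hg))]
  filter_upwards [ae_sliceEnergy_comparison hν hw hwk hg hf₁ hg₁] with s hs
  exact Filter.Eventually.of_forall fun τ hτ => (hs τ hτ).mono fun p hp => hp.1

/-- Ordered integrands with finite integrals have equal integrals exactly when they agree almost
everywhere. At fixed levels, agreement for almost all pairs of lines means a shared centre: one
direction is the strict equality case of Riesz, the other is translation invariance of overlaps. -/
theorem layerEnergy_rearrangement_eq_iff [SFinite ν] (hν : ν (Iio 0) = 0) (hw : Measurable w)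
    (hwk : ∀ᵐ z : EuclideanSpace ℝ (Fin d),
      ∃ κ, IsSymmKernel (fun u => w (z, u)) κ ∧ StrictSymmDecreasing κ)
    (hf : Measurable f) (hg : Measurable g) (hfm : Measurable f₁) (hgm : Measurable g₁)
    (hg0 : ∀ x, 0 ≤ g x) (hg0' : ∀ x, 0 ≤ g₁ x)
    (hf₁ : IsRearrangement f f₁) (hg₁ : IsRearrangement g g₁)
    (hfin : layerEnergy ν w f g ≠ ∞) :
    layerEnergy ν w f₁ g₁ = layerEnergy ν w f g ↔
      ∀ᵐ s ∂ν, ∀ᵐ τ : ℝ, 0 < τ → SharedCenter f g (τ + s) τ := by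
  have hwk' : ∀ᵐ z : EuclideanSpace ℝ (Fin d), ∃ κ, IsSymmKernel (fun u => w (z, u)) κ :=
    hwk.mono fun z ⟨κ, h, _⟩ => ⟨κ, h⟩
  have hle := layerEnergy_rearrangement_le hν hw hwk' hf hg hfm hgm hg0 hg0' hf₁ hg₁
  have hcmp := ae_sliceEnergy_comparison hν hw hwk' hg hf₁ hg₁
  have hm := measurable_sliceEnergy hw hf hg
  have hm' := measurable_sliceEnergy hw hfm hgm
  have hae : sliceEnergy w f₁ g₁ ≤ᵐ[layerMeasure d ν] sliceEnergy w f g := by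
    rw [Filter.EventuallyLE, ae_layerMeasure_iff (measurableSet_le hm' hm)]
    filter_upwards [hcmp] with s hs
    exact Filter.Eventually.of_forall fun τ hτ => (hs τ hτ).mono fun p hp => hp.1
  have h1 : layerEnergy ν w f₁ g₁ = layerEnergy ν w f g ↔
      sliceEnergy w f₁ g₁ =ᵐ[layerMeasure d ν] sliceEnergy w f g := by
    have hfin' := ne_top_of_le_ne_top hfin hle
    rw [layerEnergy_eq ν hw hf hg hg0, layerEnergy_eq ν hw hfm hgm hg0']
    rw [layerEnergy_eq ν hw hfm hgm hg0'] at hfin'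
    exact ⟨fun h => ae_eq_of_ae_le_of_lintegral_le hae hfin' hm.aemeasurable h.ge,
      fun h => lintegral_congr_ae h⟩
  rw [h1, Filter.EventuallyEq, ae_layerMeasure_iff (measurableSet_eq_fun hm' hm)]
  refine Filter.eventually_congr ?_
  filter_upwards [hcmp, measure_eq_zero_iff_ae_notMem.1 hν] with s hs hs0
  refine Filter.eventually_congr (Filter.Eventually.of_forall fun τ => ?_)
  refine imp_congr_right fun hτ => ?_
  have hs0' : 0 ≤ s := not_lt.1 hs0
  rw [Filter.eventually_congr ((hs τ hτ).mono fun p hp => hp.2)]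
  refine ⟨fun h => sharedCenter_of_ae hf hg ?_, fun h => h.ae_overlap_eq hf hg w⟩
  have hfp : ∀ᵐ p : EuclideanSpace ℝ (Fin d) × EuclideanSpace ℝ (Fin d), ∀ τ : ℝ, 0 < τ →
      volume {t : ℝ | τ < f (p.1, t)} ≠ ∞ ∧
        {t : ℝ | τ < f₁ (p.1, t)} =ᵐ[volume] schwarzSet {t : ℝ | τ < f (p.1, t)} :=
    Measure.quasiMeasurePreserving_fst.ae hf₁
  have hgp : ∀ᵐ p : EuclideanSpace ℝ (Fin d) × EuclideanSpace ℝ (Fin d), ∀ τ : ℝ, 0 < τ →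
      volume {t : ℝ | τ < g (p.2, t)} ≠ ∞ ∧
        {t : ℝ | τ < g₁ (p.2, t)} =ᵐ[volume] schwarzSet {t : ℝ | τ < g (p.2, t)} :=
    Measure.quasiMeasurePreserving_snd.ae hg₁
  filter_upwards [h, hfp, hgp, ae_sub_of_ae hwk] with p hp hp1 hp2 ⟨κ, hκ, hκs⟩ hA hB
  exact hκ.exists_equivIntervalAround hκs (hp1 _ (by linarith)).1 (hp2 _ hτ).1 hA hB
    (measurableSet_slice hf _ _) (measurableSet_slice hg _ _) hp

end

/-! ### Level sets and measurability of the Steiner symmetrization -/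

theorem steiner_nonneg (f : SplitSpace d → ℝ) (x : SplitSpace d) : 0 ≤ steiner f x :=
  Real.sSup_nonneg fun _ h => h.1.le

theorem steiner_congr {f f' : SplitSpace d → ℝ} {x' : EuclideanSpace ℝ (Fin d)}
    (h : ∀ᵐ t : ℝ, f (x', t) = f' (x', t)) (t : ℝ) : steiner f (x', t) = steiner f' (x', t) := by
  have : ∀ τ : ℝ, schwarzSet {y : ℝ | τ < f (x', y)} = schwarzSet {y : ℝ | τ < f' (x', y)} :=
    fun τ => schwarzSet_congr <| by
      filter_upwards [h] with y hy
      exact propext (by change τ < f (x', y) ↔ τ < f' (x', y); rw [hy])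
  simp only [steiner, this]

/-- The measure of `{f > τ}` is right-continuous in `τ`, so membership in the symmetrized level set
persists at slightly higher levels. The point `t = 0` is excluded because for an unbounded slice the
set of levels there may be unbounded, and `sSup` then takes its default value `0`. -/
theorem lt_steiner_iff {f : SplitSpace d → ℝ} {x' : EuclideanSpace ℝ (Fin d)}
    (hf : Measurable fun t : ℝ => f (x', t))
    (hfin : ∀ τ : ℝ, 0 < τ → volume {t : ℝ | τ < f (x', t)} < ∞) {t : ℝ} (ht : t ≠ 0) {τ : ℝ}
    (hτ : 0 ≤ τ) :
    τ < steiner f (x', t) ↔ t ∈ schwarzSet {y : ℝ | τ < f (x', y)} := by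
  -- The level sets have finite measure and decrease to `∅`, so their measure eventually drops below
  -- `2 * |t| > 0`.
  have hbdd : BddAbove {τ : ℝ | 0 < τ ∧ t ∈ schwarzSet {y : ℝ | τ < f (x', y)}} := by
    have h := tendsto_measure_iInter_atTop (μ := volume)
      (s := fun n : ℕ => {y : ℝ | (n : ℝ) + 1 < f (x', y)})
      (fun n => (measurableSet_lt measurable_const hf).nullMeasurableSet)
      (fun m n hmn y (hy : (n : ℝ) + 1 < f (x', y)) =>
        show (m : ℝ) + 1 < f (x', y) from lt_of_le_of_lt (by gcongr) hy)
      ⟨0, (hfin _ (by positivity)).ne⟩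
    have h0 : (⋂ n : ℕ, {y : ℝ | (n : ℝ) + 1 < f (x', y)}) = ∅ := by
      refine eq_empty_of_forall_notMem fun y hy => ?_
      obtain ⟨n, hn⟩ := exists_nat_gt (f (x', y))
      have : (n : ℝ) + 1 < f (x', y) := mem_iInter.1 hy n
      linarith
    rw [h0, measure_empty] at h
    have hpos : (0 : ℝ≥0∞) < ENNReal.ofReal (2 * |t|) := ENNReal.ofReal_pos.2 (by positivity)
    obtain ⟨n, hn⟩ := (h.eventually (gt_mem_nhds hpos)).exists
    refine ⟨n + 1, fun σ hσ => ?_⟩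
    by_contra! hlt
    have h1 : ENNReal.ofReal (2 * |t|) < volume {y : ℝ | σ < f (x', y)} := hσ.2
    have h2 : volume {y : ℝ | σ < f (x', y)} ≤ volume {y : ℝ | (n : ℝ) + 1 < f (x', y)} :=
      measure_mono fun y hy => hlt.trans hy
    exact absurd (h1.trans_le h2) (not_lt.2 hn.le)
  constructor
  · intro h
    have hne : {τ : ℝ | 0 < τ ∧ t ∈ schwarzSet {y : ℝ | τ < f (x', y)}}.Nonempty := by
      by_contra hne
      rw [not_nonempty_iff_eq_empty] at hne
      simp only [steiner, hne, Real.sSup_empty] at h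
      linarith
    obtain ⟨σ, hσ, hlt⟩ := exists_lt_of_lt_csSup hne h
    exact lt_of_lt_of_le hσ.2 (measure_mono fun y hy => hlt.trans hy)
  · intro h
    have h1 := tendsto_measure_iUnion_atTop (μ := volume)
      (s := fun n : ℕ => {y : ℝ | τ + 1 / ((n : ℝ) + 1) < f (x', y)})
      (fun m n hmn y (hy : τ + 1 / ((m : ℝ) + 1) < f (x', y)) =>
        show τ + 1 / ((n : ℝ) + 1) < f (x', y) from lt_of_le_of_lt (by gcongr) hy)
    have h2 : (⋃ n : ℕ, {y : ℝ | τ + 1 / ((n : ℝ) + 1) < f (x', y)}) = {y | τ < f (x', y)} := by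
      ext y
      simp only [mem_iUnion, mem_ofPred_eq]
      constructor
      · rintro ⟨n, hn⟩
        have : 0 < 1 / ((n : ℝ) + 1) := by positivity
        linarith
      · intro hy
        obtain ⟨n, hn⟩ := exists_nat_one_div_lt (sub_pos.2 hy)
        exact ⟨n, by linarith⟩
    rw [h2] at h1
    obtain ⟨n, hn⟩ := (h1.eventually (lt_mem_nhds h)).exists
    have hpos : 0 < 1 / ((n : ℝ) + 1) := by positivity
    exact lt_of_lt_of_le (lt_add_of_pos_right τ hpos) (le_csSup hbdd ⟨by linarith, hn⟩)

theorem ae_snd_ne_zero : ∀ᵐ x : SplitSpace d, x.2 ≠ 0 :=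
  Measure.quasiMeasurePreserving_snd.ae (Measure.ae_ne volume (0 : ℝ))

/-- Setting `steiner f` to zero on the exceptional lines and on `xₙ = 0` changes it on a null set
only. Elsewhere its superlevel sets compare `2 * |xₙ|` with a measurable function of `x'`. -/
theorem exists_measurable_rearrangement {f : SplitSpace d → ℝ} (hf : Measurable f)
    (hfin : ∀ᵐ x' : EuclideanSpace ℝ (Fin d), ∀ τ : ℝ, 0 < τ →
      volume {t : ℝ | τ < f (x', t)} < ∞) :
    ∃ f₁ : SplitSpace d → ℝ, Measurable f₁ ∧ (∀ x, 0 ≤ f₁ x) ∧ steiner f =ᵐ[volume] f₁ ∧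
      IsRearrangement f f₁ := by
  obtain ⟨N, hN, hNm, hN0⟩ := exists_measurable_superset_of_null (ae_iff.1 hfin)
  have hgood : ∀ x' ∉ N, ∀ τ : ℝ, 0 < τ → volume {t : ℝ | τ < f (x', t)} < ∞ := fun x' hx' => by
    by_contra hcon
    exact hx' (hN hcon)
  have hNae : ∀ᵐ x' : EuclideanSpace ℝ (Fin d), x' ∉ N := measure_eq_zero_iff_ae_notMem.1 hN0
  obtain ⟨D, hD⟩ : ∃ D : Set (SplitSpace d), D = {x | x.1 ∉ N ∧ x.2 ≠ 0} := ⟨_, rfl⟩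
  have hDm : MeasurableSet D := by
    rw [hD]
    exact (measurable_fst hNm.compl).inter (measurable_snd (measurableSet_singleton 0).compl)
  have hslice : ∀ x', Measurable fun t : ℝ => f (x', t) := fun x' => hf.comp measurable_prodMk_left
  have hD_iff : ∀ x ∈ D, ∀ τ : ℝ, 0 ≤ τ →
      (τ < steiner f x ↔ x.2 ∈ schwarzSet {y : ℝ | τ < f (x.1, y)}) := fun x hx τ hτ => by
    rw [hD] at hx
    exact lt_steiner_iff (hslice x.1) (hgood x.1 hx.1) hx.2 hτ
  refine ⟨D.indicator (steiner f), measurable_of_Ioi fun τ => ?_,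
    fun x => indicator_nonneg (fun x _ => steiner_nonneg f x) x, ?_, ?_⟩
  · rcases lt_or_ge τ 0 with hτ | hτ
    · convert MeasurableSet.univ
      exact eq_univ_of_forall fun x =>
        hτ.trans_le (indicator_nonneg (fun x _ => steiner_nonneg f x) x)
    · have : D.indicator (steiner f) ⁻¹' Ioi τ =
          D ∩ {x | ENNReal.ofReal (2 * |x.2|) < volume {y : ℝ | τ < f (x.1, y)}} := by
        ext x
        by_cases hx : x ∈ D
        · simp only [mem_preimage, indicator_of_mem hx, mem_Ioi, hD_iff x hx τ hτ, mem_inter_iff,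
            hx, true_and]
          rfl
        · simp [hx, hτ]
      rw [this]
      have hm1 : Measurable fun x' : EuclideanSpace ℝ (Fin d) => volume {y : ℝ | τ < f (x', y)} :=
        measurable_measure_prodMk_left (measurableSet_lt measurable_const hf)
      exact hDm.inter (measurableSet_lt (by fun_prop) (hm1.comp measurable_fst))
  · filter_upwards [ae_snd_ne_zero (d := d), Measure.quasiMeasurePreserving_fst.ae hNae]
      with x h1 h2
    have : x ∈ D := by rw [hD]; exact ⟨h2, h1⟩
    rw [indicator_of_mem this]
  · filter_upwards [hNae] with x' hx' τ hτ
    refine ⟨(hgood x' hx' τ hτ).ne, ?_⟩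
    filter_upwards [Measure.ae_ne volume (0 : ℝ)] with t ht
    have : (x', t) ∈ D := by rw [hD]; exact ⟨hx', ht⟩
    apply propext
    change τ < D.indicator (steiner f) (x', t) ↔ _
    rw [indicator_of_mem this]
    exact hD_iff _ this τ hτ.le

/-! ### The inequality and its equality case for a general profile -/

theorem nonlocalEnergy_congr (J : ℝ → ℝ) (k : SplitSpace d → ℝ) {f f' g g' : SplitSpace d → ℝ}
    (hf : f =ᵐ[volume] f') (hg : g =ᵐ[volume] g') :
    nonlocalEnergy J k f g = nonlocalEnergy J k f' g' := by
  unfold nonlocalEnergy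
  refine lintegral_congr_ae ?_
  filter_upwards [hf] with x hx
  refine lintegral_congr_ae ?_
  filter_upwards [hg] with y hy
  rw [hx, hy]

theorem measurable_lintegral_ofReal_sub (ν : Measure ℝ) [SFinite ν] :
    Measurable fun t : ℝ => ∫⁻ s, ENNReal.ofReal (t - s) ∂ν := by
  have : Measurable fun z : ℝ × ℝ => ENNReal.ofReal (z.1 - z.2) := by fun_prop
  exact this.lintegral_prod_right'

theorem lintegral_ofReal_sub_eq_zero {ν : Measure ℝ} (hν : ν (Iio 0) = 0) {t : ℝ} (ht : t ≤ 0) :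
    ∫⁻ s, ENNReal.ofReal (t - s) ∂ν = 0 := by
  rw [← lintegral_zero (μ := ν)]
  refine lintegral_congr_ae ?_
  filter_upwards [measure_eq_zero_iff_ae_notMem.1 hν] with s hs
  have hs' : 0 ≤ s := not_lt.1 hs
  exact ENNReal.ofReal_eq_zero.2 (by linarith)

/-- At each `t` at most one of the two ramp integrals is non-zero. The part of `J` on the negative
half-line becomes a layer energy once `x` and `y` are exchanged, which swaps `f` and `g` and
reflects the kernel. -/
theorem nonlocalEnergy_eq_layerEnergy_add {J : ℝ → ℝ} (hJ : ∀ t, 0 ≤ J t) {k : SplitSpace d → ℝ}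
    {w : SplitSpace d → ℝ≥0∞} (hw : Measurable w)
    (hkw : (fun x => ENNReal.ofReal (k x)) =ᵐ[volume] w)
    {ν₁ ν₂ : Measure ℝ} [SFinite ν₁] [SFinite ν₂] (h1 : ν₁ (Iio 0) = 0) (h2 : ν₂ (Iio 0) = 0)
    (hJ1 : ∀ t, 0 ≤ t → ENNReal.ofReal (J t) = ∫⁻ s, ENNReal.ofReal (t - s) ∂ν₁)
    (hJ2 : ∀ t, 0 ≤ t → ENNReal.ofReal (J (-t)) = ∫⁻ s, ENNReal.ofReal (t - s) ∂ν₂)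
    {f g : SplitSpace d → ℝ} (hf : Measurable f) (hg : Measurable g) :
    nonlocalEnergy J k f g = layerEnergy ν₁ w f g + layerEnergy ν₂ (fun x => w (-x)) g f := by
  have m1 := measurable_lintegral_ofReal_sub ν₁
  have m2 := measurable_lintegral_ofReal_sub ν₂
  have hJsum : ∀ t, ENNReal.ofReal (J t) =
      (∫⁻ s, ENNReal.ofReal (t - s) ∂ν₁) + ∫⁻ s, ENNReal.ofReal (-t - s) ∂ν₂ := fun t => by
    rcases le_total 0 t with ht | ht
    · rw [lintegral_ofReal_sub_eq_zero h2 (by linarith : -t ≤ 0), add_zero, hJ1 t ht]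
    · rw [lintegral_ofReal_sub_eq_zero h1 ht, zero_add, ← hJ2 (-t) (by linarith), neg_neg]
  have e1 : nonlocalEnergy J k f g = ∫⁻ x, ∫⁻ y,
      ((∫⁻ s, ENNReal.ofReal (f x - g y - s) ∂ν₁) * w (x - y) +
        (∫⁻ s, ENNReal.ofReal (g y - f x - s) ∂ν₂) * w (x - y)) := by
    unfold nonlocalEnergy
    congr 1
    funext x
    refine lintegral_congr_ae ?_
    have hinv : (volume : Measure (SplitSpace d)).IsAddLeftInvariant :=
      inferInstanceAs ((volume : Measure (EuclideanSpace ℝ (Fin d))).prod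
        (volume : Measure ℝ)).IsAddLeftInvariant
    have := (quasiMeasurePreserving_sub_left (volume : Measure (SplitSpace d)) x).ae_eq_comp hkw
    filter_upwards [this] with y hy
    rw [ENNReal.ofReal_mul (hJ _), hJsum, ← add_mul, neg_sub]
    congr 1
  have m3 : Measurable fun z : SplitSpace d × SplitSpace d =>
      (∫⁻ s, ENNReal.ofReal (f z.1 - g z.2 - s) ∂ν₁) * w (z.1 - z.2) :=
    (m1.comp (f := fun z : SplitSpace d × SplitSpace d => f z.1 - g z.2)
      (by fun_prop)).mul (by fun_prop)
  have m4 : Measurable fun z : SplitSpace d × SplitSpace d =>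
      (∫⁻ s, ENNReal.ofReal (g z.2 - f z.1 - s) ∂ν₂) * w (z.1 - z.2) :=
    (m2.comp (f := fun z : SplitSpace d × SplitSpace d => g z.2 - f z.1)
      (by fun_prop)).mul (by fun_prop)
  rw [e1]
  have e2 : ∀ x, ∫⁻ y, ((∫⁻ s, ENNReal.ofReal (f x - g y - s) ∂ν₁) * w (x - y) +
        (∫⁻ s, ENNReal.ofReal (g y - f x - s) ∂ν₂) * w (x - y)) =
      (∫⁻ y, (∫⁻ s, ENNReal.ofReal (f x - g y - s) ∂ν₁) * w (x - y)) +
        ∫⁻ y, (∫⁻ s, ENNReal.ofReal (g y - f x - s) ∂ν₂) * w (x - y) := fun x =>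
    lintegral_add_left (m3.comp measurable_prodMk_left) _
  simp_rw [e2]
  rw [lintegral_add_left m3.lintegral_prod_right', lintegral_lintegral_swap (f := fun x y =>
    (∫⁻ s, ENNReal.ofReal (g y - f x - s) ∂ν₂) * w (x - y)) m4.aemeasurable]
  simp only [layerEnergy, neg_sub]

/-- A negative value at `u` would bound the function away from zero on the whole half-line beyond
`|u|`. -/
theorem SymmDecreasing.nonneg_of_integrable {κ : ℝ → ℝ} (hκ : SymmDecreasing κ)
    (h : Integrable κ) (u : ℝ) : 0 ≤ κ u := by
  by_contra! hu
  have h1 := h.measure_norm_ge_lt_top (neg_pos.2 hu)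
  have h2 : Ici |u| ⊆ {t | -κ u ≤ ‖κ t‖} := fun t ht => by
    have h3 : κ t ≤ κ u := hκ u t (le_trans ht (le_abs_self t))
    change -κ u ≤ ‖κ t‖
    rw [Real.norm_eq_abs, abs_of_neg (h3.trans_lt hu)]
    linarith
  have := (measure_mono h2).trans_lt h1
  simp at this

theorem IsSymmKernel.comp_neg {w : ℝ → ℝ≥0∞} {κ : ℝ → ℝ} (h : IsSymmKernel w κ) :
    IsSymmKernel (fun u => w (-u)) κ where
  symm := h.symm
  nonneg := h.nonneg
  ae_eq := by
    filter_upwards [(Measure.measurePreserving_neg (volume : Measure ℝ)).quasiMeasurePreserving.ae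
      h.ae_eq] with u hu
    rw [hu, le_antisymm (h.symm u (-u) (by simp)) (h.symm (-u) u (by simp))]
  finite := by
    rw [lintegral_neg_eq_self]
    exact h.finite

theorem ae_isSymmKernel {k : SplitSpace d → ℝ} (hk : Integrable k volume)
    (hk_symm : ∀ x' : EuclideanSpace ℝ (Fin d), SymmDecreasing (fun t => k (x', t)))
    {w : SplitSpace d → ℝ≥0∞} (hkw : (fun x => ENNReal.ofReal (k x)) =ᵐ[volume] w) :
    ∀ᵐ z : EuclideanSpace ℝ (Fin d), IsSymmKernel (fun u => w (z, u)) fun u => k (z, u) := by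
  have h1 : ∀ᵐ z : EuclideanSpace ℝ (Fin d), Integrable fun u : ℝ => k (z, u) := hk.prod_right_ae
  have h2 : ∀ᵐ z : EuclideanSpace ℝ (Fin d), ∀ᵐ u : ℝ, ENNReal.ofReal (k (z, u)) = w (z, u) :=
    Measure.ae_ae_of_ae_prod hkw
  filter_upwards [h1, h2] with z hz hz'
  have hae : (fun u => w (z, u)) =ᵐ[volume] fun u => ENNReal.ofReal (k (z, u)) := by
    filter_upwards [hz'] with u hu using hu.symm
  refine ⟨hk_symm z, (hk_symm z).nonneg_of_integrable hz, hae, ?_⟩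
  rw [lintegral_congr_ae hae]
  exact hz.lintegral_lt_top.ne

theorem ae_isSymmKernel_neg {k : SplitSpace d → ℝ} (hk : Integrable k volume)
    (hk_symm : ∀ x' : EuclideanSpace ℝ (Fin d), SymmDecreasing (fun t => k (x', t)))
    {w : SplitSpace d → ℝ≥0∞} (hkw : (fun x => ENNReal.ofReal (k x)) =ᵐ[volume] w) :
    ∀ᵐ z : EuclideanSpace ℝ (Fin d), IsSymmKernel (fun u => w (-(z, u))) fun u => k (-z, u) := by
  filter_upwards [(Measure.measurePreserving_neg
    (volume : Measure (EuclideanSpace ℝ (Fin d)))).quasiMeasurePreserving.ae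
      (ae_isSymmKernel hk hk_symm hkw)] with z hz
  exact hz.comp_neg

theorem SharedCenter.symm {f g : SplitSpace d → ℝ} {σ τ : ℝ} (h : SharedCenter f g σ τ) :
    SharedCenter g f τ σ := by
  rcases h with h | h | ⟨c, h⟩
  · exact Or.inr (Or.inl h)
  · exact Or.inl h
  · exact Or.inr (Or.inr ⟨c, h.mono fun _ h => h.symm⟩)

/-- The rearrangement inequality and its equality case for a profile `J` which is given by layer
measures `ν₁` on the positive and `ν₂` on the negative half-line. -/
theorem nonlocalEnergy_steiner_le_and_eq_iff {J : ℝ → ℝ} (hJ : ∀ t, 0 ≤ J t)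
    {k : SplitSpace d → ℝ} (hk_int : Integrable k volume)
    (hk_symm : ∀ x' : EuclideanSpace ℝ (Fin d), SymmDecreasing (fun t => k (x', t)))
    {ν₁ ν₂ : Measure ℝ} [SFinite ν₁] [SFinite ν₂] (h1 : ν₁ (Iio 0) = 0) (h2 : ν₂ (Iio 0) = 0)
    (hJ1 : ∀ t, 0 ≤ t → ENNReal.ofReal (J t) = ∫⁻ s, ENNReal.ofReal (t - s) ∂ν₁)
    (hJ2 : ∀ t, 0 ≤ t → ENNReal.ofReal (J (-t)) = ∫⁻ s, ENNReal.ofReal (t - s) ∂ν₂)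
    {f g : SplitSpace d → ℝ} (hf : Measurable f) (hg : Measurable g)
    (hf0 : ∀ x, 0 ≤ f x) (hg0 : ∀ x, 0 ≤ g x)
    (hf_level : ∀ᵐ x' : EuclideanSpace ℝ (Fin d), ∀ τ : ℝ, 0 < τ →
      volume {t : ℝ | τ < f (x', t)} < ∞)
    (hg_level : ∀ᵐ x' : EuclideanSpace ℝ (Fin d), ∀ τ : ℝ, 0 < τ →
      volume {t : ℝ | τ < g (x', t)} < ∞) :
    nonlocalEnergy J k (steiner f) (steiner g) ≤ nonlocalEnergy J k f g ∧
    (nonlocalEnergy J k f g < ∞ →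
      (∀ x' : EuclideanSpace ℝ (Fin d), StrictSymmDecreasing (fun t => k (x', t))) →
      (nonlocalEnergy J k f g = nonlocalEnergy J k (steiner f) (steiner g) ↔
        (∀ᵐ s ∂ν₁, ∀ᵐ τ : ℝ, 0 < τ → SharedCenter f g (τ + s) τ) ∧
          ∀ᵐ s ∂ν₂, ∀ᵐ τ : ℝ, 0 < τ → SharedCenter g f (τ + s) τ)) := by
  obtain ⟨w, hw, hkw⟩ := hk_int.aemeasurable.ennreal_ofReal
  obtain ⟨f₁, hf₁m, hf₁0, hf₁s, hf₁⟩ := exists_measurable_rearrangement hf hf_level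
  obtain ⟨g₁, hg₁m, hg₁0, hg₁s, hg₁⟩ := exists_measurable_rearrangement hg hg_level
  have hwn : Measurable fun x => w (-x) := hw.comp measurable_neg
  have hk1 := ae_isSymmKernel hk_int hk_symm hkw
  have hk2 := ae_isSymmKernel_neg hk_int hk_symm hkw
  rw [nonlocalEnergy_congr J k hf₁s hg₁s,
    nonlocalEnergy_eq_layerEnergy_add hJ hw hkw h1 h2 hJ1 hJ2 hf hg,
    nonlocalEnergy_eq_layerEnergy_add hJ hw hkw h1 h2 hJ1 hJ2 hf₁m hg₁m]
  have le1 := layerEnergy_rearrangement_le h1 hw (hk1.mono fun z h => ⟨_, h⟩) hf hg hf₁m hg₁m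
    hg0 hg₁0 hf₁ hg₁
  have le2 := layerEnergy_rearrangement_le h2 hwn (hk2.mono fun z h => ⟨_, h⟩) hg hf hg₁m hf₁m
    hf0 hf₁0 hg₁ hf₁
  refine ⟨add_le_add le1 le2, fun hfin hstrict => ?_⟩
  obtain ⟨fin1, fin2⟩ := ENNReal.add_lt_top.1 hfin
  rw [← layerEnergy_rearrangement_eq_iff h1 hw (hk1.mono fun z h => ⟨_, h, hstrict z⟩) hf hg hf₁m
    hg₁m hg0 hg₁0 hf₁ hg₁ fin1.ne, ← layerEnergy_rearrangement_eq_iff h2 hwn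
    (hk2.mono fun z h => ⟨_, h, hstrict (-z)⟩) hg hf hg₁m hf₁m hf0 hf₁0 hg₁ hf₁ fin2.ne]
  refine ⟨fun h => ?_, fun h => by rw [h.1, h.2]⟩
  have f1 : layerEnergy ν₁ w f₁ g₁ ≠ ∞ := ne_top_of_le_ne_top fin1.ne le1
  -- Both layer energies can only decrease and all are finite, so equality of the sums forces
  -- equality of each.
  have e1 : layerEnergy ν₁ w f₁ g₁ = layerEnergy ν₁ w f g := by
    refine le_antisymm le1 ((ENNReal.add_le_add_iff_right fin2.ne).1 ?_)
    rw [h]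
    gcongr
  refine ⟨e1, ?_⟩
  rw [← e1] at h
  exact ((ENNReal.add_right_inj f1).1 h).symm

/-! ### One centre for all levels when the profile is strictly convex -/

/-- Almost all slices of the superlevel set `{f > σ}` are intervals centred at `c`. -/
def Centered (f : SplitSpace d → ℝ) (σ c : ℝ) : Prop :=
  ∀ᵐ x' : EuclideanSpace ℝ (Fin d), EquivIntervalAround {t : ℝ | σ < f (x', t)} c

/-- The radii are bounded by half the measure of the union. Passing to open intervals makes the
union exactly the open interval whose radius is their supremum. -/
theorem equivIntervalAround_iUnion {A : ℕ → Set ℝ} {c : ℝ} (h : ∀ n, EquivIntervalAround (A n) c)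
    (hfin : volume (⋃ n, A n) ≠ ∞) : EquivIntervalAround (⋃ n, A n) c := by
  choose r hr hA using h
  have hvol : ∀ n, r n ≤ volume.real (⋃ n, A n) / 2 := fun n => by
    have h1 := measureReal_mono (μ := volume) (subset_iUnion A n) hfin
    rw [measureReal_congr (hA n), Measure.real, Real.volume_Icc,
      ENNReal.toReal_ofReal (by linarith [hr n])] at h1
    linarith
  have hbdd : BddAbove (range r) := ⟨_, by rintro _ ⟨n, rfl⟩; exact hvol n⟩
  have hU : ⋃ n, Ioo (c - r n) (c + r n) = Ioo (c - ⨆ n, r n) (c + ⨆ n, r n) := by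
    ext t
    have key : ∀ ρ : ℝ, t ∈ Ioo (c - ρ) (c + ρ) ↔ |t - c| < ρ := fun ρ => by
      rw [abs_lt, mem_Ioo]
      constructor <;> rintro ⟨h, h'⟩ <;> constructor <;> linarith
    simp only [mem_iUnion, key]
    exact (lt_ciSup_iff hbdd).symm
  refine ⟨⨆ n, r n, Real.iSup_nonneg hr, ?_⟩
  have h1 : (⋃ n, A n) =ᵐ[volume] ⋃ n, Ioo (c - r n) (c + r n) :=
    Filter.EventuallyEq.countable_iUnion fun n => (hA n).trans Ioo_ae_eq_Icc.symm
  rw [hU] at h1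
  exact h1.trans Ioo_ae_eq_Icc

theorem centered_of_volume_eq_zero {f : SplitSpace d → ℝ} (hf : Measurable f) {σ : ℝ}
    (h : volume {x : SplitSpace d | σ < f x} = 0) (c : ℝ) : Centered f σ c :=
  ((volume_superlevel_eq_zero_iff hf σ).1 h).mono fun _ h =>
    equivIntervalAround_of_volume_eq_zero h c

theorem Centered.unique {f : SplitSpace d → ℝ} (hf : Measurable f) {σ c c' : ℝ}
    (h0 : volume {x : SplitSpace d | σ < f x} ≠ 0) (h : Centered f σ c) (h' : Centered f σ c') :
    c = c' := by
  rw [Ne, volume_superlevel_eq_zero_iff hf] at h0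
  obtain ⟨x', h1, h2, h3⟩ := ((Filter.not_eventually.1 h0).and_eventually (h.and h')).exists
  exact h2.center_unique h1 h3

/-- `{f > σ}` is a countable union of level sets `{f > σ'}` with `σ'` approaching `σ` from above.
This extends a centre known on a dense set of levels to all levels. -/
theorem Centered.of_gt {f : SplitSpace d → ℝ} {σ c : ℝ}
    (hfin : ∀ᵐ x' : EuclideanSpace ℝ (Fin d), volume {t : ℝ | σ < f (x', t)} ≠ ∞)
    (h : ∀ ε, 0 < ε → ∃ σ', σ < σ' ∧ σ' < σ + ε ∧ Centered f σ' c) : Centered f σ c := by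
  choose! s hs hs' hc using h
  have hall : ∀ᵐ x' : EuclideanSpace ℝ (Fin d), ∀ n : ℕ,
      EquivIntervalAround {t : ℝ | s (1 / ((n : ℝ) + 1)) < f (x', t)} c :=
    ae_all_iff.2 fun n => hc _ (by positivity)
  filter_upwards [hfin, hall] with x' hx hx'
  have hU : ⋃ n : ℕ, {t : ℝ | s (1 / ((n : ℝ) + 1)) < f (x', t)} = {t : ℝ | σ < f (x', t)} := by
    ext t
    simp only [mem_iUnion, mem_ofPred_eq]
    constructor
    · rintro ⟨n, hn⟩
      exact (hs _ (by positivity)).trans hn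
    · intro ht
      obtain ⟨n, hn⟩ := exists_nat_one_div_lt (sub_pos.2 ht)
      exact ⟨n, (hs' (1 / ((n : ℝ) + 1)) (by positivity)).trans (by linarith)⟩
  rw [← hU] at hx ⊢
  exact equivIntervalAround_iUnion hx' hx

theorem exists_pos_level {f : SplitSpace d → ℝ} (hf0 : ∀ x, 0 ≤ f x) (h : ¬ f =ᵐ[volume] 0) :
    ∃ σ, 0 < σ ∧ volume {x : SplitSpace d | σ < f x} ≠ 0 := by
  by_contra! hcon
  refine h ?_
  have hall : ∀ᵐ x : SplitSpace d, ∀ n : ℕ, ¬ 1 / ((n : ℝ) + 1) < f x :=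
    ae_all_iff.2 fun n => measure_eq_zero_iff_ae_notMem.1 (hcon _ (by positivity))
  filter_upwards [hall] with x hx
  refine le_antisymm ?_ (hf0 x)
  by_contra! hlt
  obtain ⟨n, hn⟩ := exists_nat_one_div_lt hlt
  exact hx n hn

/-- If, for levels `τ` outside a null set, `{f > τ + s}` and `{g > τ}` share their centre for a dense
set of `s`, then the centre of `{g > τ}` is that of all higher superlevel sets of `f`. -/
theorem exists_centered_of_shared {f g : SplitSpace d → ℝ} (hf : Measurable f) (hg : Measurable g)
    (hf_level : ∀ᵐ x' : EuclideanSpace ℝ (Fin d), ∀ τ : ℝ, 0 < τ →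
      volume {t : ℝ | τ < f (x', t)} < ∞)
    {τ σ₀ : ℝ} (hτ : 0 < τ) (hτσ : τ < σ₀) (hf₀ : volume {x : SplitSpace d | σ₀ < f x} ≠ 0)
    (hg₀ : volume {x : SplitSpace d | τ < g x} ≠ 0)
    (h : ∀ a b : ℚ, 0 ≤ a → a < b → ∃ s : ℝ, a < s ∧ s < b ∧ SharedCenter f g (τ + s) τ) :
    ∃ c, Centered g τ c ∧ ∀ σ, τ ≤ σ → Centered f σ c := by
  have hdense : ∀ a b : ℝ, 0 ≤ a → a < b → ∃ s : ℝ, a < s ∧ s < b ∧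
      SharedCenter f g (τ + s) τ := fun a b ha hab => by
    obtain ⟨p, hp, hp'⟩ := exists_rat_btwn hab
    obtain ⟨q, hq, hq'⟩ := exists_rat_btwn hp'
    obtain ⟨s, hs, hs', hsc⟩ := h p q (by exact_mod_cast ha.trans hp.le) (by exact_mod_cast hq)
    exact ⟨s, hp.trans hs, hs'.trans hq', hsc⟩
  -- Taking `τ + s₀ < σ₀` makes `{f > τ + s₀}` non-null, so this pair of levels really has a common
  -- centre.
  obtain ⟨s₀, hs₀, hs₀', hsc⟩ := hdense 0 (σ₀ - τ) le_rfl (by linarith)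
  have hpos : volume {x : SplitSpace d | τ + s₀ < f x} ≠ 0 := fun h0 =>
    hf₀ (measure_mono_null (fun x (hx : σ₀ < f x) => show τ + s₀ < f x by linarith) h0)
  obtain ⟨c, hc⟩ := (hsc.resolve_left hpos).resolve_left hg₀
  have hcg : Centered g τ c := hc.mono fun _ h => h.2
  refine ⟨c, hcg, fun σ hσ => Centered.of_gt ?_ fun ε hε => ?_⟩
  · filter_upwards [hf_level] with x' hx' using (hx' σ (hτ.trans_le hσ)).ne
  · obtain ⟨s, hs, hs', hsc⟩ := hdense (σ - τ) (σ - τ + ε) (by linarith) (by linarith)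
    refine ⟨τ + s, by linarith, by linarith, ?_⟩
    rcases hsc with h0 | h0 | ⟨c', hc'⟩
    · exact centered_of_volume_eq_zero hf h0 c
    · exact absurd h0 hg₀
    · have : Centered g τ c' := hc'.mono fun _ h => h.2
      rw [hcg.unique hg hg₀ this]
      exact hc'.mono fun _ h => h.1

/-- This interchanges "almost every `s`" and "almost every `τ`". Each rational interval in `[0, ∞)`
is charged by `ν` and so contains a good `s`, and the countably many null sets of `τ` can be united.
-/
theorem ae_exists_shared {f g : SplitSpace d → ℝ} {ν : Measure ℝ}
    (hν : ∀ a b, 0 ≤ a → a < b → ν (Ioo a b) ≠ 0)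
    (h : ∀ᵐ s ∂ν, ∀ᵐ τ : ℝ, 0 < τ → SharedCenter f g (τ + s) τ) :
    ∀ᵐ τ : ℝ, 0 < τ → ∀ a b : ℚ, 0 ≤ a → a < b →
      ∃ s : ℝ, a < s ∧ s < b ∧ SharedCenter f g (τ + s) τ := by
  have h1 : ∀ a b : ℚ, 0 ≤ a → a < b → ∀ᵐ τ : ℝ, 0 < τ →
      ∃ s : ℝ, a < s ∧ s < b ∧ SharedCenter f g (τ + s) τ := fun a b ha hab => by
    obtain ⟨s, hs, hs'⟩ : ∃ s ∈ Ioo (a : ℝ) b, ∀ᵐ τ : ℝ, 0 < τ → SharedCenter f g (τ + s) τ := by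
      by_contra hcon
      have hsub : Ioo (a : ℝ) b ⊆ _ := fun s hs hP => hcon ⟨s, hs, hP⟩
      exact hν a b (by exact_mod_cast ha) (by exact_mod_cast hab)
        (measure_mono_null hsub (ae_iff.1 h))
    exact hs'.mono fun τ hτ h0 => ⟨s, hs.1, hs.2, hτ h0⟩
  have h2 : ∀ᵐ τ : ℝ, ∀ a b : ℚ, 0 ≤ a → a < b → 0 < τ →
      ∃ s : ℝ, a < s ∧ s < b ∧ SharedCenter f g (τ + s) τ := by
    refine ae_all_iff.2 fun a => ae_all_iff.2 fun b => ?_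
    by_cases ha : 0 ≤ a
    · by_cases hab : a < b
      · exact (h1 a b ha hab).mono fun τ h _ _ => h
      · exact Filter.Eventually.of_forall fun τ _ h => absurd h hab
    · exact Filter.Eventually.of_forall fun τ h => absurd h ha
  exact h2.mono fun τ h h0 a b ha hab => h a b ha hab h0

/-- All superlevel sets of `f` and `g` have a common centre. -/
theorem exists_common_center {f g : SplitSpace d → ℝ} (hf : Measurable f) (hg : Measurable g)
    (hf0 : ∀ x, 0 ≤ f x) (hg0 : ∀ x, 0 ≤ g x)
    (hf_level : ∀ᵐ x' : EuclideanSpace ℝ (Fin d), ∀ τ : ℝ, 0 < τ →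
      volume {t : ℝ | τ < f (x', t)} < ∞)
    (hg_level : ∀ᵐ x' : EuclideanSpace ℝ (Fin d), ∀ τ : ℝ, 0 < τ →
      volume {t : ℝ | τ < g (x', t)} < ∞)
    {ν₁ ν₂ : Measure ℝ} (hν₁ : ∀ a b, 0 ≤ a → a < b → ν₁ (Ioo a b) ≠ 0)
    (hν₂ : ∀ a b, 0 ≤ a → a < b → ν₂ (Ioo a b) ≠ 0)
    (h₁ : ∀ᵐ s ∂ν₁, ∀ᵐ τ : ℝ, 0 < τ → SharedCenter f g (τ + s) τ)
    (h₂ : ∀ᵐ s ∂ν₂, ∀ᵐ τ : ℝ, 0 < τ → SharedCenter g f (τ + s) τ)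
    (hfne : ¬ f =ᵐ[volume] 0) (hgne : ¬ g =ᵐ[volume] 0) :
    ∃ c, ∀ σ, 0 < σ → Centered f σ c ∧ Centered g σ c := by
  obtain ⟨a, ha, hfa⟩ := exists_pos_level hf0 hfne
  obtain ⟨b, hb, hgb⟩ := exists_pos_level hg0 hgne
  have hfpos : ∀ σ ≤ a, volume {x : SplitSpace d | σ < f x} ≠ 0 := fun σ hσ h0 =>
    hfa (measure_mono_null (fun x (hx : a < f x) => hσ.trans_lt hx) h0)
  have hgpos : ∀ σ ≤ b, volume {x : SplitSpace d | σ < g x} ≠ 0 := fun σ hσ h0 =>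
    hgb (measure_mono_null (fun x (hx : b < g x) => hσ.trans_lt hx) h0)
  have key : ∀ ε, 0 < ε → ∃ τ, 0 < τ ∧ τ < ε ∧ ∃ c, ∀ σ, τ ≤ σ →
      Centered f σ c ∧ Centered g σ c := fun ε hε => by
    have hm : 0 < min ε (min a b) := lt_min hε (lt_min ha hb)
    -- Almost every `τ` serves both one-sided conditions. One below `a` and `b` also keeps `{f > τ}`
    -- and `{g > τ}` non-null.
    obtain ⟨τ, ⟨hτ0, hτ1⟩, hs1, hs2⟩ : ∃ τ ∈ Ioo 0 (min ε (min a b)),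
        (0 < τ → ∀ a b : ℚ, 0 ≤ a → a < b →
          ∃ s : ℝ, a < s ∧ s < b ∧ SharedCenter f g (τ + s) τ) ∧
        (0 < τ → ∀ a b : ℚ, 0 ≤ a → a < b →
          ∃ s : ℝ, a < s ∧ s < b ∧ SharedCenter g f (τ + s) τ) := by
      by_contra hcon
      have hsub : Ioo 0 (min ε (min a b)) ⊆ _ := fun τ hτ hP => hcon ⟨τ, hτ, hP⟩
      have := measure_mono_null hsub
        (ae_iff.1 ((ae_exists_shared hν₁ h₁).and (ae_exists_shared hν₂ h₂)))
      rw [Real.volume_Ioo, ENNReal.ofReal_eq_zero] at this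
      linarith
    have hτa : τ < a := hτ1.trans_le ((min_le_right _ _).trans (min_le_left _ _))
    have hτb : τ < b := hτ1.trans_le ((min_le_right _ _).trans (min_le_right _ _))
    obtain ⟨c, hcg, hc⟩ := exists_centered_of_shared hf hg hf_level hτ0 hτa hfa (hgpos τ hτb.le)
      (hs1 hτ0)
    obtain ⟨c', -, hc'⟩ := exists_centered_of_shared hg hf hg_level hτ0 hτb hgb (hfpos τ hτa.le)
      (hs2 hτ0)
    -- The non-null set `{g > τ}` is centred at both `c` and `c'`.
    have hcc : c' = c := (hc' τ le_rfl).unique hg (hgpos τ hτb.le) hcg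
    exact ⟨τ, hτ0, hτ1.trans_le (min_le_left _ _), c, fun σ hσ => ⟨hc σ hσ, hcc ▸ hc' σ hσ⟩⟩
  -- The non-null level set `{f > a}` serves as reference: it forces the centres obtained from ever
  -- smaller `τ` to coincide.
  obtain ⟨τ₀, hτ₀, hτ₀a, c, hc⟩ := key a ha
  refine ⟨c, fun σ hσ => ?_⟩
  obtain ⟨τ, hτ, hτσ, c', hc'⟩ := key (min σ a) (lt_min hσ ha)
  have : c' = c := (hc' a (hτσ.trans_le (min_le_right _ _)).le).1.unique hf hfa (hc a hτ₀a.le).1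
  rw [← this]
  exact hc' σ (hτσ.trans_le (min_le_left _ _)).le

theorem ae_sub_ne_zero (c : ℝ) : ∀ᵐ t : ℝ, t - c ≠ 0 := by
  filter_upwards [Measure.ae_ne volume c] with t ht using sub_ne_zero.2 ht

/-- Two non-negative numbers coincide if they exceed the same positive rationals. Restricting to
rational levels leaves only countably many null sets. -/
theorem ae_eq_steiner_translate {f : SplitSpace d → ℝ} {x' : EuclideanSpace ℝ (Fin d)}
    (hf : Measurable fun t : ℝ => f (x', t)) (hf0 : ∀ x, 0 ≤ f x)
    (hfin : ∀ τ : ℝ, 0 < τ → volume {t : ℝ | τ < f (x', t)} < ∞) {c : ℝ}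
    (h : ∀ q : ℚ, 0 < q → EquivIntervalAround {t : ℝ | q < f (x', t)} c) :
    ∀ᵐ t : ℝ, f (x', t) = steiner f (x', t - c) := by
  have h1 : ∀ᵐ t : ℝ, ∀ q : ℚ, 0 < q →
      (q < f (x', t) ↔ t - c ∈ schwarzSet {t : ℝ | q < f (x', t)}) := by
    refine ae_all_iff.2 fun q => ?_
    by_cases hq : 0 < q
    · filter_upwards [(h q hq).ae_eq_schwarzSet] with t ht _
      exact iff_of_eq ht
    · exact Filter.Eventually.of_forall fun t hq' => absurd hq' hq
  filter_upwards [h1, ae_sub_ne_zero c] with t ht htc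
  have key : ∀ q : ℚ, 0 < q → (q < f (x', t) ↔ q < steiner f (x', t - c)) := fun q hq => by
    rw [ht q hq, lt_steiner_iff hf hfin htc (by exact_mod_cast hq.le)]
  refine le_antisymm ?_ ?_
  · by_contra! hlt
    obtain ⟨q, hq, hq'⟩ := exists_rat_btwn hlt
    have hq0 : 0 < q := by exact_mod_cast (steiner_nonneg f (x', t - c)).trans_lt hq
    exact absurd ((key q hq0).1 hq') (not_lt.2 hq.le)
  · by_contra! hlt
    obtain ⟨q, hq, hq'⟩ := exists_rat_btwn hlt
    have hq0 : 0 < q := by exact_mod_cast (hf0 (x', t)).trans_lt hq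
    exact absurd ((key q hq0).2 hq') (not_lt.2 hq.le)

theorem equivIntervalAround_of_ae_eq_steiner {f : SplitSpace d → ℝ}
    {x' : EuclideanSpace ℝ (Fin d)} (hf : Measurable fun t : ℝ => f (x', t))
    (hfin : ∀ τ : ℝ, 0 < τ → volume {t : ℝ | τ < f (x', t)} < ∞) {c : ℝ}
    (h : ∀ᵐ t : ℝ, f (x', t) = steiner f (x', t - c)) {τ : ℝ} (hτ : 0 < τ) :
    EquivIntervalAround {t : ℝ | τ < f (x', t)} c := by
  refine EquivIntervalAround.of_ae_eq_schwarzSet (hfin τ hτ).ne ?_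
  filter_upwards [h, ae_sub_ne_zero c] with t ht htc
  apply propext
  change τ < f (x', t) ↔ t - c ∈ schwarzSet _
  rw [ht, lt_steiner_iff hf hfin htc hτ.le]

theorem volume_superlevel_of_ae_eq_zero {f : SplitSpace d → ℝ} (h : f =ᵐ[volume] 0) {τ : ℝ}
    (hτ : 0 < τ) : volume {x : SplitSpace d | τ < f x} = 0 := by
  refine measure_eq_zero_iff_ae_notMem.2 ?_
  filter_upwards [h] with x hx
  rw [hx]
  exact not_lt.2 hτ.le

/-- The equality conditions for a strictly convex profile. -/
theorem sharedCenter_iff_translate {f g : SplitSpace d → ℝ} (hf : Measurable f) (hg : Measurable g)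
    (hf0 : ∀ x, 0 ≤ f x) (hg0 : ∀ x, 0 ≤ g x)
    (hf_level : ∀ᵐ x' : EuclideanSpace ℝ (Fin d), ∀ τ : ℝ, 0 < τ →
      volume {t : ℝ | τ < f (x', t)} < ∞)
    (hg_level : ∀ᵐ x' : EuclideanSpace ℝ (Fin d), ∀ τ : ℝ, 0 < τ →
      volume {t : ℝ | τ < g (x', t)} < ∞)
    {ν₁ ν₂ : Measure ℝ} (hν₁' : ν₁ (Iio 0) = 0) (hν₂' : ν₂ (Iio 0) = 0)
    (hν₁ : ∀ a b, 0 ≤ a → a < b → ν₁ (Ioo a b) ≠ 0)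
    (hν₂ : ∀ a b, 0 ≤ a → a < b → ν₂ (Ioo a b) ≠ 0) :
    ((∀ᵐ s ∂ν₁, ∀ᵐ τ : ℝ, 0 < τ → SharedCenter f g (τ + s) τ) ∧
      ∀ᵐ s ∂ν₂, ∀ᵐ τ : ℝ, 0 < τ → SharedCenter g f (τ + s) τ) ↔
      (f =ᵐ[volume] 0 ∨ g =ᵐ[volume] 0 ∨
        ∃ c : ℝ, ∀ᵐ x' : EuclideanSpace ℝ (Fin d),
          ∀ᵐ t : ℝ, f (x', t) = steiner f (x', t - c) ∧ g (x', t) = steiner g (x', t - c)) := by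
  have hsf : ∀ x', Measurable fun t : ℝ => f (x', t) := fun x' => hf.comp measurable_prodMk_left
  have hsg : ∀ x', Measurable fun t : ℝ => g (x', t) := fun x' => hg.comp measurable_prodMk_left
  constructor
  · rintro ⟨h₁, h₂⟩
    by_cases hfz : f =ᵐ[volume] 0
    · exact Or.inl hfz
    by_cases hgz : g =ᵐ[volume] 0
    · exact Or.inr (Or.inl hgz)
    refine Or.inr (Or.inr ?_)
    obtain ⟨c, hc⟩ := exists_common_center hf hg hf0 hg0 hf_level hg_level hν₁ hν₂ h₁ h₂ hfz hgz
    refine ⟨c, ?_⟩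
    have hall : ∀ᵐ x' : EuclideanSpace ℝ (Fin d), ∀ q : ℚ, 0 < q →
        EquivIntervalAround {t : ℝ | q < f (x', t)} c ∧
          EquivIntervalAround {t : ℝ | q < g (x', t)} c := by
      refine ae_all_iff.2 fun q => ?_
      by_cases hq : 0 < q
      · have := hc q (by exact_mod_cast hq)
        exact (this.1.and this.2).mono fun _ h _ => h
      · exact Filter.Eventually.of_forall fun _ hq' => absurd hq' hq
    filter_upwards [hall, hf_level, hg_level] with x' hx hxf hxg
    exact (ae_eq_steiner_translate (hsf x') hf0 hxf fun q hq => (hx q hq).1).and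
      (ae_eq_steiner_translate (hsg x') hg0 hxg fun q hq => (hx q hq).2)
  · intro h
    have key : ∀ σ τ, 0 < σ → 0 < τ → SharedCenter f g σ τ := by
      intro σ τ hσ hτ
      rcases h with h | h | ⟨c, h⟩
      · exact Or.inl (volume_superlevel_of_ae_eq_zero h hσ)
      · exact Or.inr (Or.inl (volume_superlevel_of_ae_eq_zero h hτ))
      · refine Or.inr (Or.inr ⟨c, ?_⟩)
        filter_upwards [h, hf_level, hg_level] with x' hx hxf hxg
        exact ⟨equivIntervalAround_of_ae_eq_steiner (hsf x') hxf (hx.mono fun _ h => h.1) hσ,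
          equivIntervalAround_of_ae_eq_steiner (hsg x') hxg (hx.mono fun _ h => h.2) hτ⟩
    constructor
    · filter_upwards [measure_eq_zero_iff_ae_notMem.1 hν₁'] with s hs
      have hs0 : 0 ≤ s := not_lt.1 hs
      exact Filter.Eventually.of_forall fun τ hτ => key _ _ (by linarith) hτ
    · filter_upwards [measure_eq_zero_iff_ae_notMem.1 hν₂'] with s hs
      have hs0 : 0 ≤ s := not_lt.1 hs
      exact Filter.Eventually.of_forall fun τ hτ => (key _ _ hτ (by linarith)).symm

/-! ### The theorem for Borel functions -/

theorem rearrangement_of_measurable (J : ℝ → ℝ)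
    (hJ_nonneg : ∀ t, 0 ≤ J t) (hJ_convex : ConvexOn ℝ Set.univ J) (hJ_zero : J 0 = 0)
    (k : SplitSpace d → ℝ) (hk_int : Integrable k volume)
    (hk_symm : ∀ x' : EuclideanSpace ℝ (Fin d), SymmDecreasing (fun t => k (x', t)))
    (f g : SplitSpace d → ℝ) (hf : Measurable f) (hg : Measurable g)
    (hf0 : ∀ x, 0 ≤ f x) (hg0 : ∀ x, 0 ≤ g x)
    (hf_level : ∀ᵐ x' : EuclideanSpace ℝ (Fin d), ∀ τ : ℝ, 0 < τ →
      volume {t : ℝ | τ < f (x', t)} < ∞)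
    (hg_level : ∀ᵐ x' : EuclideanSpace ℝ (Fin d), ∀ τ : ℝ, 0 < τ →
      volume {t : ℝ | τ < g (x', t)} < ∞) :
    nonlocalEnergy J k (steiner f) (steiner g) ≤ nonlocalEnergy J k f g ∧
    (nonlocalEnergy J k f g < ∞ →
      (∀ x' : EuclideanSpace ℝ (Fin d), StrictSymmDecreasing (fun t => k (x', t))) →
      (StrictConvexOn ℝ Set.univ J →
        (nonlocalEnergy J k f g = nonlocalEnergy J k (steiner f) (steiner g) ↔
          (f =ᵐ[volume] 0 ∨ g =ᵐ[volume] 0 ∨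
            ∃ c : ℝ, ∀ᵐ x' : EuclideanSpace ℝ (Fin d),
              ∀ᵐ t : ℝ, f (x', t) = steiner f (x', t - c) ∧
                g (x', t) = steiner g (x', t - c)))) ∧
      ((∀ t, J t = |t|) →
        (nonlocalEnergy J k f g = nonlocalEnergy J k (steiner f) (steiner g) ↔
          ∀ᵐ τ : ℝ, 0 < τ → SharedCenter f g τ τ))) := by
  have hJ'_convex : ConvexOn ℝ univ fun t => J (-t) :=
    ⟨convex_univ, fun x _ y _ a b ha hb hab => by
      have := hJ_convex.2 (mem_univ (-x)) (mem_univ (-y)) ha hb hab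
      simpa [neg_add, add_comm] using this⟩
  have hJ'_strict : StrictConvexOn ℝ univ J → StrictConvexOn ℝ univ fun t => J (-t) := fun h =>
    ⟨convex_univ, fun x _ y _ hxy a b ha hb hab => by
      have := h.2 (mem_univ (-x)) (mem_univ (-y)) (by simpa using hxy) ha hb hab
      simpa [neg_add, add_comm] using this⟩
  obtain ⟨ν₁, _, hν₁, hJ1, hs1⟩ := hJ_convex.exists_measure_lintegral_eq hJ_nonneg hJ_zero
  obtain ⟨ν₂, _, hν₂, hJ2, hs2⟩ := hJ'_convex.exists_measure_lintegral_eq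
    (fun t => hJ_nonneg (-t)) (by simpa using hJ_zero)
  have main := nonlocalEnergy_steiner_le_and_eq_iff hJ_nonneg hk_int hk_symm hν₁ hν₂ hJ1 hJ2 hf hg
    hf0 hg0 hf_level hg_level
  refine ⟨main.1, fun hfin hstrict => ⟨fun hJs => ?_, fun hJabs => ?_⟩⟩
  · rw [main.2 hfin hstrict]
    exact sharedCenter_iff_translate hf hg hf0 hg0 hf_level hg_level hν₁ hν₂ (hs1 hJs)
      (hs2 (hJ'_strict hJs))
  -- For `|t|` both layer measures can be taken to be the Dirac mass at `0`, so only the pairs of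
  -- levels `(τ, τ)` occur.
  · have hδ : (Measure.dirac (0 : ℝ)) (Iio 0) = 0 := by simp
    have main' := nonlocalEnergy_steiner_le_and_eq_iff hJ_nonneg hk_int hk_symm hδ hδ
      (fun t ht => by simp [hJabs, abs_of_nonneg ht]) (fun t ht => by simp [hJabs, abs_of_nonneg ht])
      hf hg hf0 hg0 hf_level hg_level
    rw [main'.2 hfin hstrict]
    simp only [ae_dirac_eq, Filter.eventually_pure, add_zero]
    exact ⟨fun h => h.1, fun h => ⟨h, h.mono fun τ hτ h0 => (hτ h0).symm⟩⟩

/-! ### Invariance under modification on null sets -/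

theorem sharedCenter_congr {f f' g g' : SplitSpace d → ℝ} (hf : f =ᵐ[volume] f')
    (hg : g =ᵐ[volume] g') {σ τ : ℝ} (h : SharedCenter f g σ τ) : SharedCenter f' g' σ τ := by
  have level : ∀ {p p' : SplitSpace d → ℝ}, p =ᵐ[volume] p' → ∀ ρ : ℝ,
      volume {x | ρ < p x} = 0 → volume {x | ρ < p' x} = 0 := fun {p p'} hp ρ h0 => by
    have h1 := measure_eq_zero_iff_ae_notMem.1 h0
    refine measure_eq_zero_iff_ae_notMem.2 ?_
    filter_upwards [hp, h1] with x hx hx' hx''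
    exact hx' (show ρ < p x by rw [hx]; exact hx'')
  have slice : ∀ {p p' : SplitSpace d → ℝ}, p =ᵐ[volume] p' → ∀ ρ : ℝ,
      ∀ᵐ x' : EuclideanSpace ℝ (Fin d), {t : ℝ | ρ < p (x', t)} =ᵐ[volume]
        {t : ℝ | ρ < p' (x', t)} := fun {p p'} hp ρ => by
    have h1 : ∀ᵐ x' : EuclideanSpace ℝ (Fin d), ∀ᵐ t : ℝ, p (x', t) = p' (x', t) :=
      Measure.ae_ae_of_ae_prod hp
    filter_upwards [h1] with x' hx'
    filter_upwards [hx'] with t ht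
    exact propext (by change ρ < p (x', t) ↔ ρ < p' (x', t); rw [ht])
  rcases h with h | h | ⟨c, h⟩
  · exact Or.inl (level hf σ h)
  · exact Or.inr (Or.inl (level hg τ h))
  · refine Or.inr (Or.inr ⟨c, ?_⟩)
    filter_upwards [h, slice hf σ, slice hg τ] with x' hx h1 h2
    exact ⟨hx.1.congr h1, hx.2.congr h2⟩

theorem ae_steiner_eq {f f' : SplitSpace d → ℝ} (h : f =ᵐ[volume] f') :
    ∀ᵐ x' : EuclideanSpace ℝ (Fin d), ∀ t, steiner f (x', t) = steiner f' (x', t) := by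
  have h1 : ∀ᵐ x' : EuclideanSpace ℝ (Fin d), ∀ᵐ t : ℝ, f (x', t) = f' (x', t) :=
    Measure.ae_ae_of_ae_prod h
  exact h1.mono fun x' hx' t => steiner_congr hx' t

theorem level_congr {f f' : SplitSpace d → ℝ} (h : f =ᵐ[volume] f')
    (hf : ∀ᵐ x' : EuclideanSpace ℝ (Fin d), ∀ τ : ℝ, 0 < τ →
      volume {t : ℝ | τ < f (x', t)} < ∞) :
    ∀ᵐ x' : EuclideanSpace ℝ (Fin d), ∀ τ : ℝ, 0 < τ →
      volume {t : ℝ | τ < f' (x', t)} < ∞ := by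
  have h1 : ∀ᵐ x' : EuclideanSpace ℝ (Fin d), ∀ᵐ t : ℝ, f (x', t) = f' (x', t) :=
    Measure.ae_ae_of_ae_prod h
  filter_upwards [h1, hf] with x' hx hx' τ hτ
  have h2 : {t : ℝ | τ < f' (x', t)} =ᵐ[volume] {t : ℝ | τ < f (x', t)} := by
    filter_upwards [hx] with t ht
    exact propext (by change τ < f' (x', t) ↔ τ < f (x', t); rw [ht])
  rw [measure_congr h2]
  exact hx' τ hτ

theorem translate_congr {f f' g g' : SplitSpace d → ℝ} (hf : f =ᵐ[volume] f')
    (hg : g =ᵐ[volume] g') {c : ℝ}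
    (h : ∀ᵐ x' : EuclideanSpace ℝ (Fin d), ∀ᵐ t : ℝ, f (x', t) = steiner f (x', t - c) ∧
      g (x', t) = steiner g (x', t - c)) :
    ∀ᵐ x' : EuclideanSpace ℝ (Fin d), ∀ᵐ t : ℝ, f' (x', t) = steiner f' (x', t - c) ∧
      g' (x', t) = steiner g' (x', t - c) := by
  have h1 : ∀ᵐ x' : EuclideanSpace ℝ (Fin d), ∀ᵐ t : ℝ, f (x', t) = f' (x', t) :=
    Measure.ae_ae_of_ae_prod hf
  have h2 : ∀ᵐ x' : EuclideanSpace ℝ (Fin d), ∀ᵐ t : ℝ, g (x', t) = g' (x', t) :=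
    Measure.ae_ae_of_ae_prod hg
  filter_upwards [h, h1, h2, ae_steiner_eq hf, ae_steiner_eq hg] with x' hx hx1 hx2 hx3 hx4
  filter_upwards [hx, hx1, hx2] with t ht ht1 ht2
  rw [← ht1, ← ht2, ← hx3, ← hx4]
  exact ht

theorem exists_measurable_nonneg_modification {f : SplitSpace d → ℝ} (hf : AEMeasurable f volume)
    (hf0 : ∀ x, 0 ≤ f x) :
    ∃ f' : SplitSpace d → ℝ, Measurable f' ∧ (∀ x, 0 ≤ f' x) ∧ f =ᵐ[volume] f' := by
  obtain ⟨f', hm, h⟩ := hf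
  refine ⟨fun x => max 0 (f' x), measurable_const.max hm, fun x => le_max_left _ _, ?_⟩
  filter_upwards [h] with x hx
  rw [← hx, max_eq_right (hf0 x)]

end Energy

theorem mainTheorem6 (d : ℕ) (J : ℝ → ℝ)
    (hJ_nonneg : ∀ t, 0 ≤ J t) (hJ_convex : ConvexOn ℝ Set.univ J) (hJ_zero : J 0 = 0)
    (k : SplitSpace d → ℝ) (hk_int : Integrable k volume)
    (hk_symm : ∀ x' : EuclideanSpace ℝ (Fin d), SymmDecreasing (fun t => k (x', t)))
    (f g : SplitSpace d → ℝ)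
    (hf_meas : AEMeasurable f volume) (hg_meas : AEMeasurable g volume)
    (hf_nonneg : ∀ x, 0 ≤ f x) (hg_nonneg : ∀ x, 0 ≤ g x)
    (hf_level : ∀ᵐ x' : EuclideanSpace ℝ (Fin d), ∀ τ : ℝ, 0 < τ →
      volume {t : ℝ | τ < f (x', t)} < ∞)
    (hg_level : ∀ᵐ x' : EuclideanSpace ℝ (Fin d), ∀ τ : ℝ, 0 < τ →
      volume {t : ℝ | τ < g (x', t)} < ∞) :
    nonlocalEnergy J k (steiner f) (steiner g) ≤ nonlocalEnergy J k f g ∧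
    (nonlocalEnergy J k f g < ∞ →
      (∀ x' : EuclideanSpace ℝ (Fin d), StrictSymmDecreasing (fun t => k (x', t))) →
      (StrictConvexOn ℝ Set.univ J →
        (nonlocalEnergy J k f g = nonlocalEnergy J k (steiner f) (steiner g) ↔
          (f =ᵐ[volume] 0 ∨ g =ᵐ[volume] 0 ∨
            ∃ c : ℝ, ∀ᵐ x' : EuclideanSpace ℝ (Fin d),
              ∀ᵐ t : ℝ, f (x', t) = steiner f (x', t - c) ∧
                g (x', t) = steiner g (x', t - c)))) ∧
      ((∀ t, J t = |t|) →
        (nonlocalEnergy J k f g = nonlocalEnergy J k (steiner f) (steiner g) ↔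
          ∀ᵐ τ : ℝ, 0 < τ →
            (volume {x : SplitSpace d | τ < f x} = 0 ∨ volume {x : SplitSpace d | τ < g x} = 0 ∨
              ∃ c : ℝ, ∀ᵐ x' : EuclideanSpace ℝ (Fin d),
                EquivIntervalAround {t : ℝ | τ < f (x', t)} c ∧
                  EquivIntervalAround {t : ℝ | τ < g (x', t)} c)))) := by
  obtain ⟨f', hf', hf'0, hff⟩ := exists_measurable_nonneg_modification hf_meas hf_nonneg
  obtain ⟨g', hg', hg'0, hgg⟩ := exists_measurable_nonneg_modification hg_meas hg_nonneg
  -- The symmetrization depends only on the measures of the level sets on each line, so a null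
  -- modification affects it on a null set of lines only.
  have hsteiner : ∀ {p p' : SplitSpace d → ℝ}, p =ᵐ[volume] p' →
      steiner p =ᵐ[volume] steiner p' := fun {p p'} hp => by
    filter_upwards [Measure.quasiMeasurePreserving_fst.ae (ae_steiner_eq hp)] with x hx
    exact hx x.2
  have main := rearrangement_of_measurable J hJ_nonneg hJ_convex hJ_zero k hk_int hk_symm f' g' hf'
    hg' hf'0 hg'0 (level_congr hff hf_level) (level_congr hgg hg_level)
  rw [nonlocalEnergy_congr J k hff hgg, nonlocalEnergy_congr J k (hsteiner hff) (hsteiner hgg)]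
  refine ⟨main.1, fun hfin hstrict => ⟨fun hJs => ?_, fun hJabs => ?_⟩⟩
  · rw [(main.2 hfin hstrict).1 hJs]
    constructor
    · rintro (h | h | ⟨c, h⟩)
      · exact Or.inl (hff.trans h)
      · exact Or.inr (Or.inl (hgg.trans h))
      · exact Or.inr (Or.inr ⟨c, translate_congr hff.symm hgg.symm h⟩)
    · rintro (h | h | ⟨c, h⟩)
      · exact Or.inl (hff.symm.trans h)
      · exact Or.inr (Or.inl (hgg.symm.trans h))
      · exact Or.inr (Or.inr ⟨c, translate_congr hff hgg h⟩)
  · rw [(main.2 hfin hstrict).2 hJabs]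
    exact ⟨fun h => h.mono fun τ hτ h0 => sharedCenter_congr hff.symm hgg.symm (hτ h0),
      fun h => h.mono fun τ hτ h0 => sharedCenter_congr hff hgg (hτ h0)⟩
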